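/- **Notation.** Partitions are identified with their Ferrers diagrams; $\mathcal P$ is the set of all partitions (including $\emptyset$) and $\mathcal{SC}$ the set of those equal to their conjugate. For a box $u$ of a partition $\lambda$, $h_u$ is its hook-length, and $\varepsilon_u=-1$ if $u$ lies strictly below the main diagonal, $\varepsilon_u=1$ otherwise. $\mathcal H(\lambda)$ is the multiset of all hook-lengths of $\lambda$, and $\mathcal H_t(\lambda)$ the multiset of those divisible by $t$. Let $s(\lambda)=(c_i)_{i\in\mathbb Z}$ be the $0/1$ word of the border of $\lambda$, read from South-West to North-East ($0$ for a vertical step, $1$ for a horizontal step), indexed so that $\#\{i\le -1: c_i=1\}=\#\{i\ge 0: c_i=0\}$. For $0\le k<t$, the component $\nu^{(k)}$ of the $t$-quotient of $\lambda$ is the partition whose border word is, up to a shift of the index, $(c_{ti+k})_{i\in\mathbb Z}$. For odd $t$, put $$\mathrm{BG}^t:=\{\lambda\in\mathcal{SC} : \nu^{((t-1)/2)}=\emptyset\}.$$ Finally $(a;q)_\infty=\prod_{j\ge0}(1-aq^j)$. **Theorem.** Let $t$ be a positive odd integer and let $\tilde\rho_1,\tilde\rho_2$ be two functions on $\mathbb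 Z\times\{-1,1\}$ with values in a commutative ring (for instance $\mathbb C$). Define the formal power series $$f_t(q):=\sum_{\nu\in\mathcal P}q^{|\nu|}\prod_{h\in\mathcal H(\nu)}\tilde\rho_1(th,1)\tilde\rho_1(th,-1),$$ $$g_t(q):=\sum_{\nu\in\mathcal P}q^{|\nu|}\prod_{h\in\mathcal H(\nu)}\tilde\rho_1(th,1)\tilde\rho_1(th,-1)\sum_{h\in\mathcal H(\nu)}\bigl(\tilde\rho_2(th,1)+\tilde\rho_2(th,-1)\bigr).$$ Then, as formal power series in $q$ and $x$, $$\sum_{\lambda\in\mathrm{BG}^t}q^{|\lambda|}x^{|\mathcal H_t(\lambda)|}\prod_{\substack{u\in\lambda\\ h_u\in\mathcal H_t(\lambda)}}\tilde\rho_1(h_u,\varepsilon_u)\sum_{\substack{u\in\lambda\\ h_u\in\mathcal H_t(\lambda)}}\tilde\rho_2(h_u,\varepsilon_u) =\frac{t-1}{2}\,\bigl(f_t(x^2q^{2t})\bigr)^{(t-3)/2}\,g_t(x^2q^{2t})\,\frac{(q^{2t};q^{2t})_\infty^{(t-1)/2}\,(-q;q^2)_\infty}{(-q^t;q^{2t})_\infty}.$$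 (For $t=1$ the exponent $(t-3)/2$ is $-1$; $f_t$ is invertible since its constant term is $1$.) -/

import Mathlib

open scoped MvPowerSeries.WithPiTopology

namespace LittlewoodSC

/-! ### Partitions

A partition is identified with its Ferrers diagram, a Mathlib `YoungDiagram`; the box `(i, j)` lies
in row `i` and column `j`, both counted from `0`. -/

/-- The number of boxes of `lam` strictly to the right of `u` in its row (for `u` in `lam`). -/
def arm (lam : YoungDiagram) (u : ℕ × ℕ) : ℕ := lam.rowLen u.1 - (u.2 + 1)

/-- The number of boxes of `lam` strictly below `u` in its column (for `u` in `lam`). -/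
def leg (lam : YoungDiagram) (u : ℕ × ℕ) : ℕ := lam.colLen u.2 - (u.1 + 1)

/-- The hook-length of the box `u` of `lam`. -/
def hook (lam : YoungDiagram) (u : ℕ × ℕ) : ℕ := arm lam u + leg lam u + 1

/-- The boxes of `lam` whose hook-length is a multiple of `t`. Their hook-lengths form the multiset
`H_t(lam)`. -/
def hookBoxes (t : ℕ) (lam : YoungDiagram) : Finset (ℕ × ℕ) :=
  lam.cells.filter fun u => t ∣ hook lam u

/-- The sign of a box: `-1` strictly below the main diagonal, `1` otherwise. -/
def boxSign (u : ℕ × ℕ) : ℤˣ := if u.2 < u.1 then -1 else 1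

/-- `lam` equals its conjugate. -/
def IsSelfConjugate (lam : YoungDiagram) : Prop := lam.transpose = lam

/-- There are finitely many partitions of `n`. -/
theorem finite_card_eq (n : ℕ) : {lam : YoungDiagram | lam.card = n}.Finite := by
  refine Set.Finite.of_finite_image (f := YoungDiagram.cells)
    (((Finset.range n ×ˢ Finset.range n).powerset.finite_toSet).subset ?_)
    (fun a _ b _ h => YoungDiagram.ext h)
  rintro _ ⟨lam, rfl, rfl⟩
  simp only [Finset.coe_powerset, Set.mem_preimage, Set.mem_powerset_iff, Finset.coe_subset]
  rintro ⟨i, j⟩ hij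
  have hij : (i, j) ∈ lam := hij
  have hr : j < lam.rowLen i := YoungDiagram.mem_iff_lt_rowLen.mp hij
  have hc : i < lam.colLen j := YoungDiagram.mem_iff_lt_colLen.mp hij
  rw [YoungDiagram.rowLen_eq_card] at hr
  rw [YoungDiagram.colLen_eq_card] at hc
  simp only [Finset.mem_product, Finset.mem_range]
  exact ⟨hc.trans_le (Finset.card_le_card (Finset.filter_subset _ _)),
    hr.trans_le (Finset.card_le_card (Finset.filter_subset _ _))⟩

/-- The finite set of all partitions of `n`. -/
noncomputable def partitionsOf (n : ℕ) : Finset YoungDiagram := (finite_card_eq n).toFinset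

/-! ### Border words and the quotient of the Littlewood decomposition -/

/-- A `0/1`-word indexed by `ℤ` (`false` is `0`, `true` is `1`) which consists of `0`s far to the
left and of `1`s far to the right. -/
structure BorderWord where
  letter : ℤ → Bool
  ends : ∃ N : ℕ, (∀ i : ℤ, i < -N → letter i = false) ∧ ∀ i : ℤ, N ≤ i → letter i = true

open Classical in
/-- The word `s(lam)`: the border of the diagram is read from South-West to North-East, a vertical
step is written `0` and a horizontal step `1`. The letter `0` of the vertical step in row `r`
(counted from `0`, empty rows included) has index `lam_r - r - 1`, and all other letters are `1`;
with this choice of the origin the number of `1`s of negative index equals the number of `0`s of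
nonnegative index. -/
noncomputable def borderWord (lam : YoungDiagram) : BorderWord where
  letter n := decide (¬ ∃ r : ℕ, n = (lam.rowLen r : ℤ) - r - 1)
  ends := by
    refine ⟨lam.colLen 0 + lam.rowLen 0, fun i hi => ?_, fun i hi => ?_⟩
    · have h0 : lam.rowLen (-i - 1).toNat = 0 := by
        by_contra h
        have h1 : ((-i - 1).toNat, 0) ∈ lam :=
          YoungDiagram.mem_iff_lt_rowLen.mpr (Nat.pos_of_ne_zero h)
        have h2 := YoungDiagram.mem_iff_lt_colLen.mp h1
        push_cast at hi
        omega
      simp only [decide_eq_false_iff_not, not_not]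
      refine ⟨(-i - 1).toNat, ?_⟩
      rw [h0]
      push_cast at hi ⊢
      omega
    · simp only [decide_eq_true_eq, not_exists]
      intro r hr
      have := lam.rowLen_anti 0 r (Nat.zero_le r)
      push_cast at hi
      omega

/-- The partition encoded by a word, whatever the position of its origin: the boxes correspond to
the pairs of indices `i < j` with letters `c_i = 1` and `c_j = 0`, where the box lies in row `r` and
column `s` if exactly `r` letters `0` lie to the right of `j` and exactly `s` letters `1` lie to the
left of `i`. Such a box comes with all the boxes that lie weakly above and to the left of it. -/
noncomputable def BorderWord.toDiagram (c : BorderWord) : YoungDiagram where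
  cells := Set.Finite.toFinset (s := {p : ℕ × ℕ | ∃ i j : ℤ, i < j ∧
      c.letter i = true ∧ c.letter j = false ∧
      p.1 ≤ {k : ℤ | j < k ∧ c.letter k = false}.ncard ∧
      p.2 ≤ {k : ℤ | k < i ∧ c.letter k = true}.ncard}) <| by
    obtain ⟨N, hl, hr⟩ := c.ends
    refine ((Finset.range (2 * N + 1) ×ˢ Finset.range (2 * N + 1)).finite_toSet).subset ?_
    rintro ⟨r, s⟩ ⟨i, j, hij, hi, hj, hr', hs'⟩
    have hi0 : -(N : ℤ) ≤ i := by
      by_contra h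
      simp [hl i (by omega)] at hi
    have hj0 : j < N := by
      by_contra h
      simp [hr j (by omega)] at hj
    have hA : {k : ℤ | j < k ∧ c.letter k = false} ⊆ (Finset.Ico (-(N : ℤ)) N : Set ℤ) := by
      rintro k ⟨hk, hk'⟩
      have : k < N := by
        by_contra h
        simp [hr k (by omega)] at hk'
      simp only [Finset.coe_Ico, Set.mem_Ico]
      omega
    have hB : {k : ℤ | k < i ∧ c.letter k = true} ⊆ (Finset.Ico (-(N : ℤ)) N : Set ℤ) := by
      rintro k ⟨hk, hk'⟩
      have : -(N : ℤ) ≤ k := by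
        by_contra h
        simp [hl k (by omega)] at hk'
      simp only [Finset.coe_Ico, Set.mem_Ico]
      omega
    have hA' := Set.ncard_le_ncard hA (Finset.finite_toSet _)
    have hB' := Set.ncard_le_ncard hB (Finset.finite_toSet _)
    rw [Set.ncard_coe_finset, Int.card_Ico] at hA' hB'
    simp only [Finset.coe_product, Finset.coe_range, Set.mem_prod, Set.mem_Iio]
    dsimp only at hr' hs'
    omega
  isLowerSet := by
    rintro ⟨r, s⟩ ⟨r', s'⟩ ⟨h1, h2⟩ h
    simp only [Set.Finite.coe_toFinset, Set.mem_ofPred_eq] at h ⊢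
    obtain ⟨i, j, hij, hi, hj, hr, hs⟩ := h
    exact ⟨i, j, hij, hi, hj, le_trans h1 hr, le_trans h2 hs⟩

/-- The subword `(c_{ti+k})_i` of `c`. -/
def BorderWord.subword (c : BorderWord) (t : ℕ) (ht : 0 < t) (k : ℕ) : BorderWord where
  letter i := c.letter (t * i + k)
  ends := by
    obtain ⟨N, hl, hr⟩ := c.ends
    refine ⟨N + k, fun i hi => hl _ ?_, fun i hi => hr _ ?_⟩
    · push_cast at hi
      have : (1 : ℤ) ≤ t := by exact_mod_cast ht
      nlinarith
    · push_cast at hi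
      have : (1 : ℤ) ≤ t := by exact_mod_cast ht
      nlinarith

/-- The component `ν^(k)`, `0 ≤ k < t`, of the `t`-quotient of `lam` in the Littlewood
decomposition: the partition encoded by the letters of `s(lam)` with index congruent to `k`
modulo `t`. -/
noncomputable def quotientComponent (t : ℕ) (ht : 0 < t) (lam : YoungDiagram) (k : ℕ) :
    YoungDiagram :=
  ((borderWord lam).subword t ht k).toDiagram

/-- For odd `t`, the set `BG^t` of the self-conjugate partitions whose middle quotient component
`ν^((t-1)/2)` is empty. -/
def BG (t : ℕ) (ht : Odd t) : Set YoungDiagram :=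
  {lam | IsSelfConjugate lam ∧ quotientComponent t ht.pos lam ((t - 1) / 2) = ⊥}

/-! ### Power series -/

section Series

variable {R : Type*} [CommRing R]

/-- `f_t = ∑_ν q^|ν| ∏_{h ∈ H(ν)} ρ₁(th, 1) ρ₁(th, -1)`, where `ν` runs over all partitions. -/
noncomputable def fSeries (t : ℕ) (rho1 : ℤ → ℤˣ → R) : PowerSeries R :=
  PowerSeries.mk fun n => ∑ nu ∈ partitionsOf n,
    ∏ u ∈ nu.cells, (rho1 (t * hook nu u) 1 * rho1 (t * hook nu u) (-1))

/-- `g_t = ∑_ν q^|ν| ∏_{h ∈ H(ν)} ρ₁(th, 1) ρ₁(th, -1) ∑_{h ∈ H(ν)} (ρ₂(th, 1) + ρ₂(th, -1))`,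
where `ν` runs over all partitions. -/
noncomputable def gSeries (t : ℕ) (rho1 rho2 : ℤ → ℤˣ → R) : PowerSeries R :=
  PowerSeries.mk fun n => ∑ nu ∈ partitionsOf n,
    (∏ u ∈ nu.cells, (rho1 (t * hook nu u) 1 * rho1 (t * hook nu u) (-1))) *
      ∑ u ∈ nu.cells, (rho2 (t * hook nu u) 1 + rho2 (t * hook nu u) (-1))

/-- The variable `q` of the ring of formal power series in `q` and `x`. -/
noncomputable abbrev q (R : Type*) [CommRing R] : MvPowerSeries (Fin 2) R := MvPowerSeries.X 0

/-- The variable `x` of the ring of formal power series in `q` and `x`. -/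
noncomputable abbrev x (R : Type*) [CommRing R] : MvPowerSeries (Fin 2) R := MvPowerSeries.X 1

/-- Integer powers of an invertible element of a commutative ring. -/
noncomputable def intPow {A : Type*} [CommRing A] (a : A) : ℤ → A
  | Int.ofNat n => a ^ n
  | Int.negSucc n => Ring.inverse a ^ (n + 1)

/-- The infinite `q`-Pochhammer symbol `(a; b)_∞ = ∏_{j ≥ 0} (1 - a b^j)`. -/
noncomputable def qPochhammerInf {A : Type*} [CommRing A] [TopologicalSpace A] (a b : A) : A :=
  ∏' j : ℕ, (1 - a * b ^ j)

/-- The infinite product converges for formal power series when `b` has no constant term. -/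
theorem multipliable_qPochhammerInf [TopologicalSpace R] (a b : MvPowerSeries (Fin 2) R)
    (hb : b.constantCoeff = 0) : Multipliable fun j : ℕ => 1 - a * b ^ j := by
  simp only [sub_eq_add_neg]
  apply MvPowerSeries.WithPiTopology.multipliable_one_add_of_tendsto_order_atTop_nhds_top
  refine ENat.tendsto_nhds_top_iff_natCast_lt.mpr fun n =>
    Filter.eventually_atTop.mpr ⟨n + 1, fun m hm => ?_⟩
  have h1 : (1 : ℕ∞) ≤ b.order := by
    rw [MvPowerSeries.one_le_order_iff_constCoeff_eq_zero]
    exact hb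
  have h2 : (m : ℕ∞) ≤ (b ^ m).order :=
    le_trans (by simpa using nsmul_le_nsmul_right h1 m) (MvPowerSeries.le_order_pow m)
  have h3 : (m : ℕ∞) ≤ (-(a * b ^ m)).order := by
    rw [← neg_mul]
    exact h2.trans (le_trans le_add_self MvPowerSeries.le_order_mul)
  exact lt_of_lt_of_le (by exact_mod_cast hm) h3

end Series

end LittlewoodSC

open LittlewoodSC

/-! Write m = (t-1)/2. Conjugation reverses a border word and exchanges its letters, so it exchanges
the residues k and t-1-k. A self-conjugate word is therefore determined by its subwords of residue k
< m and its middle subword. The latter is self-conjugate, hence of charge 0, hence trivial when its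
diagram is empty. A word amounts to a charge and a diagram, so BG^t is parametrised by m integers
(the core) and m partitions ν_k (`ofCharges_bijective`), and |λ| = |core| + 2t ∑ |ν_k|
(`card_ofCharges`).

Boxes of λ are inversions of its word, pairs i < j with letters 1 and 0, and the hook-length is j -
i. If t divides it, both letters lie in one subword, so these boxes come from the boxes of the
quotient with hooks multiplied by t. In a self-conjugate word a box lies below the diagonal iff i +
j + 1 < 0. Reflection negates i + j + 1, which is nonzero outside the middle residue, so each box of
ν_k yields one box of each sign (`prod_hookBoxes`). The weights thus factor over the ν_k, and
summing over m-tuples gives m f^(m-1) g in x²q^(2t) (`hasSum_pi_prod_mul_sum`).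

The core series is found by counting BG^t by size in two ways. The quotient gives (core series) ·
(q^(2t);q^(2t))_∞^(-m). Diagonal hooks give the product of 1 + q^(2d+1) over d not congruent to m
mod t (`hasProd_diagonal`), which is (-q;q²)_∞ / (-q^t;q^(2t))_∞. Comparing the two gives the core
series (`tsum_core_eq`). -/

namespace LittlewoodSC

namespace BorderWord

variable (c : BorderWord)

@[ext]
theorem ext {c d : BorderWord} (h : ∀ i, c.letter i = d.letter i) : c = d := by
  cases c
  cases d
  simp only [mk.injEq]
  exact funext h

/-! ### Counting letters -/

/-- The number of letters `0` strictly to the right of `j`. -/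
noncomputable def zerosRight (j : ℤ) : ℕ := {k : ℤ | j < k ∧ c.letter k = false}.ncard

/-- The number of letters `1` strictly to the left of `i`. -/
noncomputable def onesLeft (i : ℤ) : ℕ := {k : ℤ | k < i ∧ c.letter k = true}.ncard

/-- The conjugate word: read backwards with the two letters exchanged. -/
def conj : BorderWord where
  letter i := !c.letter (-1 - i)
  ends := by
    obtain ⟨N, hl, hr⟩ := c.ends
    exact ⟨N + 1, fun i hi => by simp [hr (-1 - i) (by push_cast at hi; omega)],
      fun i hi => by simp [hl (-1 - i) (by push_cast at hi; omega)]⟩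

@[simp]
theorem letter_conj (i : ℤ) : c.conj.letter i = !c.letter (-1 - i) := rfl

@[simp]
theorem conj_conj : c.conj.conj = c := by
  ext i
  simp

theorem finite_zerosRight (j : ℤ) : {k : ℤ | j < k ∧ c.letter k = false}.Finite := by
  obtain ⟨N, -, hr⟩ := c.ends
  refine (Set.finite_Ioo j (N : ℤ)).subset ?_
  rintro k ⟨hk, hk'⟩
  refine ⟨hk, ?_⟩
  by_contra h
  simp [hr k (by omega)] at hk'

theorem zerosRight_conj (j : ℤ) : c.conj.zerosRight j = c.onesLeft (-1 - j) := by
  have hinj : Function.Injective fun k : ℤ => -1 - k := fun a b h => by simpa using h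
  rw [onesLeft, ← Set.ncard_image_of_injective _ hinj, zerosRight]
  congr 1
  ext k
  simp only [letter_conj, Bool.not_eq_false', Set.mem_ofPred_eq, Set.mem_image]
  constructor
  · rintro ⟨h1, h2⟩
    exact ⟨-1 - k, ⟨by omega, h2⟩, by omega⟩
  · rintro ⟨l, ⟨h1, h2⟩, rfl⟩
    exact ⟨by omega, by simpa using h2⟩

theorem onesLeft_conj (j : ℤ) : c.conj.onesLeft j = c.zerosRight (-1 - j) := by
  have := c.conj.zerosRight_conj (-1 - j)
  rw [conj_conj] at this
  rw [this]
  congr 1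
  omega

theorem zerosRight_antitone : Antitone c.zerosRight := fun i _ hij =>
  Set.ncard_le_ncard (fun _ hk => ⟨lt_of_le_of_lt hij hk.1, hk.2⟩) (c.finite_zerosRight i)

theorem onesLeft_monotone : Monotone c.onesLeft := fun _ _ hij => by
  have h := c.conj.zerosRight_antitone (sub_le_sub_left hij (-1))
  simpa [zerosRight_conj] using h

theorem zerosRight_sub_one (j : ℤ) :
    c.zerosRight (j - 1) = c.zerosRight j + if c.letter j = false then 1 else 0 := by
  unfold zerosRight
  split_ifs with h
  · rw [← Set.ncard_insert_of_notMem (a := j) (by simp) (c.finite_zerosRight j)]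
    congr 1
    ext k
    simp only [Set.mem_ofPred_eq, Set.mem_insert_iff]
    constructor
    · rintro ⟨h1, h2⟩
      rcases eq_or_ne k j with h3 | h3
      · exact Or.inl h3
      · exact Or.inr ⟨by omega, h2⟩
    · rintro (rfl | ⟨h1, h2⟩)
      · exact ⟨by omega, h⟩
      · exact ⟨by omega, h2⟩
  · rw [add_zero]
    congr 1
    ext k
    simp only [Set.mem_ofPred_eq]
    constructor
    · rintro ⟨h1, h2⟩
      have : k ≠ j := by
        rintro rfl
        exact h h2
      exact ⟨by omega, h2⟩
    · rintro ⟨h1, h2⟩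
      exact ⟨by omega, h2⟩

theorem onesLeft_add_one (i : ℤ) :
    c.onesLeft (i + 1) = c.onesLeft i + if c.letter i = true then 1 else 0 := by
  have h := c.conj.zerosRight_sub_one (-1 - i)
  rw [zerosRight_conj, zerosRight_conj] at h
  simpa [show -1 - (-1 - i - 1) = i + 1 by ring] using h

theorem zerosRight_lt {j z : ℤ} (hj : j < z) (hz : c.letter z = false) :
    c.zerosRight z < c.zerosRight j := by
  have h1 := c.zerosRight_antitone (show j ≤ z - 1 by omega)
  rw [zerosRight_sub_one, if_pos hz] at h1
  omega

theorem onesLeft_lt {i z : ℤ} (hi : i < z) (hz : c.letter i = true) :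
    c.onesLeft i < c.onesLeft z := by
  have h1 := c.onesLeft_monotone (show i + 1 ≤ z by omega)
  rw [onesLeft_add_one, if_pos hz] at h1
  omega

/-- The position of the origin of a word relative to the balanced one. -/
noncomputable def charge : ℤ := c.zerosRight (-1) - c.onesLeft 0

/-- Moving the cut one step to the right either passes a 1 or loses a 0, so the difference of the
two counts grows by exactly 1. Most position formulas below are read off from this identity. -/
theorem onesLeft_eq (j : ℤ) : (c.onesLeft j : ℤ) = c.zerosRight (j - 1) + j - c.charge := by
  induction j using Int.induction_on with
  | zero => simp [charge]
  | succ i ih =>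
    have h1 := c.onesLeft_add_one i
    have h2 := c.zerosRight_sub_one i
    rw [h1, show (i : ℤ) + 1 - 1 = i by ring]
    rw [h2] at ih
    rcases h : c.letter i <;> simp [h] at ih ⊢ <;> omega
  | pred i ih =>
    have h1 := c.onesLeft_add_one (-i - 1)
    have h2 := c.zerosRight_sub_one (-i - 1)
    rw [show -(i : ℤ) - 1 + 1 = -i by ring] at h1
    rw [h2]
    rw [h1] at ih
    rcases h : c.letter (-i - 1) <;> simp [h] at ih ⊢ <;> omega

theorem charge_conj : c.conj.charge = -c.charge := by
  simp [charge, zerosRight_conj, onesLeft_conj]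

theorem exists_onesLeft_eq_zero : ∃ N : ℕ, ∀ j : ℤ, j ≤ -N → c.onesLeft j = 0 := by
  obtain ⟨N, hl, -⟩ := c.ends
  refine ⟨N, fun j hj => ?_⟩
  have : {k : ℤ | k < j ∧ c.letter k = true} = ∅ := by
    ext k
    simp only [Set.mem_ofPred_eq, Set.mem_empty_iff_false, iff_false, not_and]
    intro hk
    simp [hl k (by omega)]
  simp [onesLeft, this]

theorem exists_zerosRight_eq_zero : ∃ N : ℕ, ∀ j : ℤ, N ≤ j → c.zerosRight j = 0 := by
  obtain ⟨N, h⟩ := c.conj.exists_onesLeft_eq_zero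
  refine ⟨N, fun j hj => ?_⟩
  have := h (-1 - j) (by omega)
  simpa [onesLeft_conj] using this

/-- The count of zeros to the right vanishes far to the right, is unbounded to the left, and changes
by at most 1 per step. It exceeds r for the last time just before the required zero. -/
theorem exists_zero (r : ℕ) : ∃ z, c.letter z = false ∧ c.zerosRight z = r := by
  obtain ⟨M, hM⟩ := c.exists_zerosRight_eq_zero
  obtain ⟨N, hN⟩ := c.exists_onesLeft_eq_zero
  have hlow : ∃ z : ℤ, r < c.zerosRight (z - 1) := by
    -- At or below -N no letter 1 lies to the left, so `onesLeft_eq` gives the count charge - z,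
    -- which is at least r + 1 here.
    refine ⟨min (-N) (c.charge - r - 1), ?_⟩
    have h1 := hN (min (-N) (c.charge - r - 1)) (min_le_left _ _)
    have h2 := c.onesLeft_eq (min (-N) (c.charge - r - 1))
    have h3 := min_le_right (-(N : ℤ)) (c.charge - r - 1)
    omega
  obtain ⟨z, hz, hmax⟩ := Int.exists_greatest_of_bdd (P := fun z => r < c.zerosRight (z - 1))
    ⟨M, fun z hz => by
      by_contra h
      have := hM (z - 1) (by omega)
      omega⟩ hlow
  have h1 : ¬ r < c.zerosRight (z + 1 - 1) := fun h => by
    have := hmax _ h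
    omega
  rw [add_sub_cancel_right] at h1
  rw [zerosRight_sub_one] at hz
  refine ⟨z, ?_, ?_⟩
  · by_contra h
    rw [if_neg h] at hz
    omega
  · split_ifs at hz <;> omega

/-! ### Enumerating the letters -/

/-- The index of the letter `0` which has exactly `r` letters `0` to its right. -/
noncomputable def zeroPos (r : ℕ) : ℤ := (c.exists_zero r).choose

/-- The index of the letter `1` which has exactly `s` letters `1` to its left. -/
noncomputable def onePos (s : ℕ) : ℤ := -1 - c.conj.zeroPos s

@[simp]
theorem letter_zeroPos (r : ℕ) : c.letter (c.zeroPos r) = false := (c.exists_zero r).choose_spec.1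

@[simp]
theorem zerosRight_zeroPos (r : ℕ) : c.zerosRight (c.zeroPos r) = r :=
  (c.exists_zero r).choose_spec.2

@[simp]
theorem letter_onePos (s : ℕ) : c.letter (c.onePos s) = true := by
  simpa [onePos] using c.conj.letter_zeroPos s

@[simp]
theorem onesLeft_onePos (s : ℕ) : c.onesLeft (c.onePos s) = s := by
  rw [onePos, ← zerosRight_conj, zerosRight_zeroPos]

theorem onePos_conj (s : ℕ) : c.conj.onePos s = -1 - c.zeroPos s := by
  rw [onePos, conj_conj]

theorem zeroPos_conj (s : ℕ) : c.conj.zeroPos s = -1 - c.onePos s := by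
  rw [onePos]
  omega

theorem le_zeroPos {r : ℕ} {z : ℤ} (hz : c.letter z = false) (h : r ≤ c.zerosRight z) :
    z ≤ c.zeroPos r := by
  by_contra hlt
  have := c.zerosRight_lt (not_le.mp hlt) hz
  rw [zerosRight_zeroPos] at this
  omega

theorem zeroPos_le {r : ℕ} {z : ℤ} (h : c.zerosRight z ≤ r) : c.zeroPos r ≤ z := by
  by_contra hlt
  have := c.zerosRight_lt (not_le.mp hlt) (c.letter_zeroPos r)
  rw [zerosRight_zeroPos] at this
  omega

theorem zeroPos_zerosRight {z : ℤ} (hz : c.letter z = false) : c.zeroPos (c.zerosRight z) = z :=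
  le_antisymm (c.zeroPos_le le_rfl) (c.le_zeroPos hz le_rfl)

theorem zeroPos_injective : Function.Injective c.zeroPos := fun a b h => by
  rw [← c.zerosRight_zeroPos a, h, zerosRight_zeroPos]

theorem onePos_injective : Function.Injective c.onePos := fun a b h => by
  rw [← c.onesLeft_onePos a, h, onesLeft_onePos]

theorem onePos_onesLeft {z : ℤ} (hz : c.letter z = true) : c.onePos (c.onesLeft z) = z := by
  have h := c.conj.zeroPos_zerosRight (z := -1 - z) (by simpa using hz)
  rw [zerosRight_conj] at h
  simp only [sub_sub_cancel] at h
  rw [onePos, h]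
  omega

theorem onePos_le {s : ℕ} {z : ℤ} (hz : c.letter z = true) (h : s ≤ c.onesLeft z) :
    c.onePos s ≤ z := by
  by_contra hlt
  have := c.onesLeft_lt (not_le.mp hlt) hz
  rw [onesLeft_onePos] at this
  omega

/-! ### The diagram of a word -/

/-- By monotonicity of the counts, the existential over pairs of letters is decided by the extremal
pair: the 1 of rank s and the 0 of rank r. -/
theorem mem_toDiagram {r s : ℕ} : (r, s) ∈ c.toDiagram ↔ c.onePos s < c.zeroPos r := by
  rw [← YoungDiagram.mem_cells]
  simp only [toDiagram, Set.Finite.mem_toFinset, Set.mem_ofPred_eq]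
  constructor
  · rintro ⟨i, j, hij, hi, hj, hr, hs⟩
    exact lt_of_le_of_lt (c.onePos_le hi hs) (lt_of_lt_of_le hij (c.le_zeroPos hj hr))
  · intro h
    exact ⟨_, _, h, c.letter_onePos s, c.letter_zeroPos r, (c.zerosRight_zeroPos r).ge,
      (c.onesLeft_onePos s).ge⟩

theorem rowLen_toDiagram (r : ℕ) : c.toDiagram.rowLen r = c.onesLeft (c.zeroPos r) := by
  refine eq_of_forall_lt_iff fun s => ?_
  rw [← YoungDiagram.mem_iff_lt_rowLen, mem_toDiagram]
  constructor
  · intro h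
    simpa using c.onesLeft_lt h (c.letter_onePos s)
  · intro h
    by_contra hle
    have := c.onesLeft_monotone (not_lt.mp hle)
    rw [onesLeft_onePos] at this
    omega

theorem toDiagram_conj : c.conj.toDiagram = c.toDiagram.transpose := by
  ext ⟨r, s⟩
  rw [YoungDiagram.mem_cells, YoungDiagram.mem_cells, YoungDiagram.mem_transpose, Prod.swap_prod_mk,
    mem_toDiagram, mem_toDiagram, onePos_conj, zeroPos_conj]
  omega

/-- This is `onesLeft_eq` at the zero of rank r, whose number of 1s to the left is the row length.
It shows that the charge and the diagram determine the word. -/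
theorem zeroPos_eq (r : ℕ) : c.zeroPos r = c.toDiagram.rowLen r - r - 1 + c.charge := by
  have h := c.onesLeft_eq (c.zeroPos r)
  rw [zerosRight_sub_one, letter_zeroPos, if_pos rfl, zerosRight_zeroPos, ← rowLen_toDiagram] at h
  push_cast at h
  omega

theorem onePos_eq (s : ℕ) : c.onePos s = s - c.toDiagram.colLen s + c.charge := by
  have h := c.conj.zeroPos_eq s
  rw [zeroPos_conj, toDiagram_conj, YoungDiagram.rowLen_transpose, charge_conj] at h
  omega

theorem hook_toDiagram {r s : ℕ} (h : (r, s) ∈ c.toDiagram) :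
    (hook c.toDiagram (r, s) : ℤ) = c.zeroPos r - c.onePos s := by
  have h1 := YoungDiagram.mem_iff_lt_rowLen.mp h
  have h2 := YoungDiagram.mem_iff_lt_colLen.mp h
  rw [zeroPos_eq, onePos_eq]
  simp only [hook, arm, leg]
  omega

theorem letter_eq_false_iff (z : ℤ) :
    c.letter z = false ↔ ∃ r : ℕ, z = c.toDiagram.rowLen r - r - 1 + c.charge := by
  constructor
  · intro h
    exact ⟨c.zerosRight z, by rw [← zeroPos_eq, zeroPos_zerosRight _ h]⟩
  · rintro ⟨r, rfl⟩
    rw [← zeroPos_eq, letter_zeroPos]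

theorem eq_of_charge_toDiagram {c d : BorderWord} (h1 : c.charge = d.charge)
    (h2 : c.toDiagram = d.toDiagram) : c = d := by
  ext z
  rw [Bool.eq_iff_iff, ← not_iff_not, Bool.not_eq_true, Bool.not_eq_true, letter_eq_false_iff,
    letter_eq_false_iff, h1, h2]

end BorderWord

/-! ### The word of a diagram -/

theorem letter_borderWord_eq_false_iff (lam : YoungDiagram) (z : ℤ) :
    (borderWord lam).letter z = false ↔ ∃ r : ℕ, z = lam.rowLen r - r - 1 := by
  simp [borderWord]

theorem zerosRight_borderWord (lam : YoungDiagram) (r : ℕ) :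
    (borderWord lam).zerosRight (lam.rowLen r - r - 1) = r := by
  have hinj : Function.Injective fun r : ℕ => (lam.rowLen r : ℤ) - r - 1 := by
    refine StrictAnti.injective fun a b hab => ?_
    have := lam.rowLen_anti a b hab.le
    omega
  have : {k : ℤ | lam.rowLen r - r - 1 < k ∧ (borderWord lam).letter k = false} =
      (fun r : ℕ => (lam.rowLen r : ℤ) - r - 1) '' (Finset.range r : Set ℕ) := by
    ext k
    simp only [letter_borderWord_eq_false_iff, Set.mem_ofPred_eq, Finset.coe_range, Set.mem_image,
      Set.mem_Iio]
    constructor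
    · rintro ⟨h1, s, rfl⟩
      refine ⟨s, ?_, rfl⟩
      by_contra h
      have := lam.rowLen_anti r s (not_lt.mp h)
      omega
    · rintro ⟨s, hs, rfl⟩
      have := lam.rowLen_anti s r hs.le
      exact ⟨by omega, s, rfl⟩
  rw [BorderWord.zerosRight, this, Set.ncard_image_of_injective _ hinj, Set.ncard_coe_finset,
    Finset.card_range]

theorem zeroPos_borderWord (lam : YoungDiagram) (r : ℕ) :
    (borderWord lam).zeroPos r = lam.rowLen r - r - 1 := by
  have h := (borderWord lam).zeroPos_zerosRight
    ((letter_borderWord_eq_false_iff lam _).mpr ⟨r, rfl⟩)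
  rwa [zerosRight_borderWord] at h

theorem rowLen_eq_zero_of_colLen_le {lam : YoungDiagram} {r : ℕ} (h : lam.colLen 0 ≤ r) :
    lam.rowLen r = 0 := by
  by_contra h1
  have h2 := YoungDiagram.mem_iff_lt_rowLen.mpr (Nat.pos_of_ne_zero h1)
  have h3 := YoungDiagram.mem_iff_lt_colLen.mp h2
  omega

theorem toDiagram_ext_of_rowLen {lam mu : YoungDiagram} (h : ∀ r, lam.rowLen r = mu.rowLen r) :
    lam = mu := by
  ext ⟨r, s⟩
  rw [YoungDiagram.mem_cells, YoungDiagram.mem_cells, YoungDiagram.mem_iff_lt_rowLen,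
    YoungDiagram.mem_iff_lt_rowLen, h]

@[simp]
theorem charge_borderWord (lam : YoungDiagram) : (borderWord lam).charge = 0 := by
  obtain ⟨N, hN⟩ := (borderWord lam).exists_onesLeft_eq_zero
  -- For a row this low, both the row of `lam` and the row of the decoded diagram are empty.
  -- Comparing the two formulas for the position of its zero isolates the charge.
  set r := max N (lam.colLen 0) with hr
  have h0 := rowLen_eq_zero_of_colLen_le (le_max_right N (lam.colLen 0))
  have h1 := zeroPos_borderWord lam r
  have h2 := (borderWord lam).zeroPos_eq r
  have h3 : N ≤ r := le_max_left _ _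
  rw [← hr] at h0
  rw [BorderWord.rowLen_toDiagram, hN _ (by rw [h1, h0]; push_cast; omega)] at h2
  rw [h1, h0] at h2
  push_cast at h2
  omega

@[simp]
theorem toDiagram_borderWord (lam : YoungDiagram) : (borderWord lam).toDiagram = lam := by
  refine toDiagram_ext_of_rowLen fun r => ?_
  have h1 := zeroPos_borderWord lam r
  have h2 := (borderWord lam).zeroPos_eq r
  rw [charge_borderWord] at h2
  omega

theorem borderWord_toDiagram {c : BorderWord} (h : c.charge = 0) : borderWord c.toDiagram = c :=
  BorderWord.eq_of_charge_toDiagram (by simp [h]) (by simp)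

theorem isSelfConjugate_iff (lam : YoungDiagram) :
    IsSelfConjugate lam ↔ (borderWord lam).conj = borderWord lam := by
  constructor
  · intro h
    refine BorderWord.eq_of_charge_toDiagram ?_ ?_
    · simp [BorderWord.charge_conj]
    · rw [BorderWord.toDiagram_conj, toDiagram_borderWord]
      exact h
  · intro h
    have := (borderWord lam).toDiagram_conj
    rw [h, toDiagram_borderWord] at this
    exact this.symm

/-- The word with a given diagram and a given charge. -/
noncomputable def shiftedWord (n : ℤ) (nu : YoungDiagram) : BorderWord where
  letter i := (borderWord nu).letter (i - n)
  ends := by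
    obtain ⟨N, hl, hr⟩ := (borderWord nu).ends
    exact ⟨N + n.natAbs, fun i hi => hl _ (by omega), fun i hi => hr _ (by omega)⟩

theorem letter_shiftedWord_eq_false_iff (n : ℤ) (nu : YoungDiagram) (z : ℤ) :
    (shiftedWord n nu).letter z = false ↔ ∃ r : ℕ, z = nu.rowLen r - r - 1 + n := by
  rw [shiftedWord, letter_borderWord_eq_false_iff]
  exact exists_congr fun r => by omega

theorem zerosRight_shiftedWord (n : ℤ) (nu : YoungDiagram) (j : ℤ) :
    (shiftedWord n nu).zerosRight j = (borderWord nu).zerosRight (j - n) := by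
  have hinj : Function.Injective fun k : ℤ => k + n := fun a b h => by simpa using h
  rw [BorderWord.zerosRight.eq_1 (borderWord nu), ← Set.ncard_image_of_injective _ hinj,
    BorderWord.zerosRight]
  congr 1
  ext k
  simp only [Set.mem_ofPred_eq, Set.mem_image]
  constructor
  · rintro ⟨h1, h2⟩
    exact ⟨k - n, ⟨by omega, h2⟩, by omega⟩
  · rintro ⟨l, ⟨h1, h2⟩, rfl⟩
    exact ⟨by omega, by simpa [shiftedWord] using h2⟩

theorem zeroPos_shiftedWord (n : ℤ) (nu : YoungDiagram) (r : ℕ) :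
    (shiftedWord n nu).zeroPos r = nu.rowLen r - r - 1 + n := by
  have h := (shiftedWord n nu).zeroPos_zerosRight
    ((letter_shiftedWord_eq_false_iff n nu _).mpr ⟨r, rfl⟩)
  rwa [zerosRight_shiftedWord, add_sub_cancel_right, zerosRight_borderWord] at h

@[simp]
theorem charge_shiftedWord (n : ℤ) (nu : YoungDiagram) : (shiftedWord n nu).charge = n := by
  obtain ⟨N, hN⟩ := (shiftedWord n nu).exists_onesLeft_eq_zero
  set r := max (N + n.natAbs) (nu.colLen 0) with hr
  have h0 := rowLen_eq_zero_of_colLen_le (le_max_right (N + n.natAbs) (nu.colLen 0))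
  have h1 := zeroPos_shiftedWord n nu r
  have h2 := (shiftedWord n nu).zeroPos_eq r
  have h3 : N + n.natAbs ≤ r := le_max_left _ _
  rw [← hr] at h0
  rw [BorderWord.rowLen_toDiagram, hN _ (by rw [h1, h0]; push_cast; omega)] at h2
  rw [h1, h0] at h2
  push_cast at h2
  omega

@[simp]
theorem toDiagram_shiftedWord (n : ℤ) (nu : YoungDiagram) : (shiftedWord n nu).toDiagram = nu := by
  refine toDiagram_ext_of_rowLen fun r => ?_
  have h1 := zeroPos_shiftedWord n nu r
  have h2 := (shiftedWord n nu).zeroPos_eq r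
  rw [charge_shiftedWord] at h2
  omega

/-- A word amounts to its charge and its diagram. -/
noncomputable def wordEquiv : BorderWord ≃ ℤ × YoungDiagram where
  toFun c := (c.charge, c.toDiagram)
  invFun p := shiftedWord p.1 p.2
  left_inv c := BorderWord.eq_of_charge_toDiagram (by simp) (by simp)
  right_inv p := by simp

namespace BorderWord

/-! ### Subwords -/

theorem letter_subword (c : BorderWord) (t : ℕ) (ht : 0 < t) (k : ℕ) (i : ℤ) :
    (c.subword t ht k).letter i = c.letter (t * i + k) := rfl

theorem subword_conj (c : BorderWord) (t : ℕ) (ht : 0 < t) {k : ℕ} (hk : k < t) :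
    c.conj.subword t ht k = (c.subword t ht (t - 1 - k)).conj := by
  ext i
  simp only [letter_subword, letter_conj]
  congr 2
  rw [Nat.sub_sub, Nat.cast_sub (by omega)]
  push_cast
  ring

theorem eq_of_subword_eq {c d : BorderWord} (t : ℕ) (ht : 0 < t)
    (h : ∀ k < t, c.subword t ht k = d.subword t ht k) : c = d := by
  ext i
  have h0 : (0 : ℤ) < t := by exact_mod_cast ht
  have h1 := Int.emod_nonneg i h0.ne'
  have h2 := Int.emod_lt_of_pos i h0
  have h3 := congrArg (fun w => w.letter (i / t)) (h (i % t).toNat (by omega))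
  simp only [letter_subword, Int.toNat_of_nonneg h1, Int.mul_ediv_add_emod] at h3
  exact h3

/-- The word with prescribed subwords. -/
def join (t : ℕ) (ht : 0 < t) (w : ℕ → BorderWord) : BorderWord where
  letter i := (w (i % t).toNat).letter (i / t)
  ends := by
    choose N hl hr using fun k => (w k).ends
    have h0 : (0 : ℤ) < t := by exact_mod_cast ht
    have hN : ∀ i : ℤ, N (i % t).toNat ≤ ∑ k ∈ Finset.range t, N k := fun i => by
      have h1 := Int.emod_nonneg i h0.ne'
      have h2 := Int.emod_lt_of_pos i h0
      exact Finset.single_le_sum (f := N) (fun _ _ => Nat.zero_le _)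
        (Finset.mem_range.mpr (by omega))
    refine ⟨t * ∑ k ∈ Finset.range t, N k, fun i hi => hl _ _ ?_, fun i hi => hr _ _ ?_⟩
    · have := hN i
      rw [Int.ediv_lt_iff_lt_mul h0]
      push_cast at hi
      have h3 : (N (i % t).toNat : ℤ) ≤ ∑ k ∈ Finset.range t, (N k : ℤ) := by exact_mod_cast this
      nlinarith
    · have := hN i
      rw [Int.le_ediv_iff_mul_le h0]
      push_cast at hi
      have h3 : (N (i % t).toNat : ℤ) ≤ ∑ k ∈ Finset.range t, (N k : ℤ) := by exact_mod_cast this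
      nlinarith

theorem subword_join (t : ℕ) (ht : 0 < t) (w : ℕ → BorderWord) {k : ℕ} (hk : k < t) :
    (join t ht w).subword t ht k = w k := by
  ext i
  have h1 : ((t : ℤ) * i + k) % t = k := by
    rw [add_comm, Int.add_mul_emod_self_left]
    exact Int.emod_eq_of_lt (by omega) (by omega)
  have h2 : ((t : ℤ) * i + k) / t = i := by
    rw [add_comm, Int.add_mul_ediv_left _ _ (by omega), Int.ediv_eq_zero_of_lt (by omega) (by omega),
      zero_add]
  simp only [letter_subword, join, h1, h2, Int.toNat_natCast]

theorem charge_eq_zero_of_conj_eq {c : BorderWord} (h : c.conj = c) : c.charge = 0 := by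
  have := c.charge_conj
  rw [h] at this
  omega

theorem eq_borderWord_bot {c : BorderWord} (h : c.conj = c) (h' : c.toDiagram = ⊥) :
    c = borderWord ⊥ := by
  rw [← h', borderWord_toDiagram (charge_eq_zero_of_conj_eq h)]

end BorderWord

/-! ### Parametrisation of BG^t by charges and half of the quotient -/

theorem conj_borderWord_bot : (borderWord ⊥).conj = borderWord ⊥ :=
  (isSelfConjugate_iff _).mp (by ext; simp)

theorem letter_borderWord_bot (z : ℤ) : (borderWord ⊥).letter z = decide (0 ≤ z) := by
  have h : ∀ r, (⊥ : YoungDiagram).rowLen r = 0 := fun r => by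
    rw [YoungDiagram.rowLen_eq_card]
    simp [YoungDiagram.row]
  rw [Bool.eq_iff_iff, ← not_iff_not, Bool.not_eq_true, letter_borderWord_eq_false_iff]
  simp only [h, decide_eq_true_eq, not_le]
  constructor
  · rintro ⟨r, rfl⟩
    omega
  · intro hz
    exact ⟨(-z - 1).toNat, by omega⟩

open BorderWord

/-- Extension of a family of words to the family of subwords of a self-conjugate word whose middle
subword is trivial. -/
noncomputable def symmetricFamily {m : ℕ} (w : Fin m → BorderWord) (k : ℕ) : BorderWord :=
  if h : k < m then w ⟨k, h⟩ else if h : 2 * m - k < m then (w ⟨2 * m - k, h⟩).conj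
  else borderWord ⊥

theorem symmetricFamily_of_lt {m : ℕ} (w : Fin m → BorderWord) (k : Fin m) :
    symmetricFamily w k = w k := by
  simp [symmetricFamily]

theorem symmetricFamily_self {m : ℕ} (w : Fin m → BorderWord) :
    symmetricFamily w m = borderWord ⊥ := by
  simp [symmetricFamily, two_mul]

theorem symmetricFamily_reflect {m : ℕ} (w : Fin m → BorderWord) {k : ℕ} (hk : k ≤ 2 * m) :
    symmetricFamily w (2 * m - k) = (symmetricFamily w k).conj := by
  unfold symmetricFamily
  rcases lt_trichotomy k m with h | h | h
  · simp only [dif_pos h, dif_neg (show ¬ 2 * m - k < m by omega)]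
    rw [dif_pos (by omega)]
    congr 3
    omega
  · subst h
    simp [two_mul, conj_borderWord_bot]
  · simp only [dif_neg (show ¬ k < m by omega)]
    simp [show 2 * m - k < m by omega]

theorem two_mul_half (t : ℕ) (ht : Odd t) : 2 * ((t - 1) / 2) + 1 = t := by
  obtain ⟨m, rfl⟩ := ht
  omega

section Odd

variable (t : ℕ) (ht : Odd t)

theorem conj_borderWord_of_mem_BG {lam : YoungDiagram} (h : lam ∈ BG t ht) :
    (borderWord lam).conj = borderWord lam :=
  (isSelfConjugate_iff lam).mp h.1

theorem subword_reflect {c : BorderWord} (h : c.conj = c) (ht : 0 < t) {k : ℕ} (hk : k < t) :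
    c.subword t ht (t - 1 - k) = (c.subword t ht k).conj := by
  have := c.subword_conj t ht (k := t - 1 - k) (by omega)
  rwa [h, show t - 1 - (t - 1 - k) = k by omega] at this

theorem subword_half {c : BorderWord} (h : c.conj = c) :
    (c.subword t ht.pos ((t - 1) / 2)).conj = c.subword t ht.pos ((t - 1) / 2) := by
  have := two_mul_half t ht
  rw [← subword_reflect t h ht.pos (by omega)]
  congr 1
  omega

/-- Membership in BG^t only constrains the diagram of the middle subword; its charge is 0 by
self-conjugacy, so the whole subword is known. -/
theorem subword_half_of_mem_BG {lam : YoungDiagram} (h : lam ∈ BG t ht) :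
    (borderWord lam).subword t ht.pos ((t - 1) / 2) = borderWord ⊥ :=
  eq_borderWord_bot (subword_half t ht (conj_borderWord_of_mem_BG t ht h)) h.2

theorem conj_join_symmetricFamily (w : Fin ((t - 1) / 2) → BorderWord) :
    (join t ht.pos (symmetricFamily w)).conj = join t ht.pos (symmetricFamily w) := by
  have := two_mul_half t ht
  refine eq_of_subword_eq t ht.pos fun k hk => ?_
  rw [subword_conj _ _ _ hk, subword_join _ _ _ hk, subword_join _ _ _ (by omega),
    show t - 1 - k = 2 * ((t - 1) / 2) - k by omega, symmetricFamily_reflect _ (by omega), conj_conj]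

theorem borderWord_toDiagram_join (w : Fin ((t - 1) / 2) → BorderWord) :
    borderWord (join t ht.pos (symmetricFamily w)).toDiagram =
      join t ht.pos (symmetricFamily w) :=
  borderWord_toDiagram (charge_eq_zero_of_conj_eq (conj_join_symmetricFamily t ht w))

theorem toDiagram_join_mem_BG (w : Fin ((t - 1) / 2) → BorderWord) :
    (join t ht.pos (symmetricFamily w)).toDiagram ∈ BG t ht := by
  have := two_mul_half t ht
  refine ⟨?_, ?_⟩
  · rw [isSelfConjugate_iff, borderWord_toDiagram_join t ht, conj_join_symmetricFamily t ht]
  · rw [quotientComponent, borderWord_toDiagram_join t ht, subword_join _ _ _ (by omega),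
      symmetricFamily_self, toDiagram_borderWord]

/-- An element of `BG t` amounts to the first half of its subwords. -/
noncomputable def equivWords : (Fin ((t - 1) / 2) → BorderWord) ≃ BG t ht where
  toFun w := ⟨(join t ht.pos (symmetricFamily w)).toDiagram, toDiagram_join_mem_BG t ht w⟩
  invFun lam k := (borderWord lam.1).subword t ht.pos k
  left_inv w := by
    have := two_mul_half t ht
    funext k
    change (borderWord (join t ht.pos (symmetricFamily w)).toDiagram).subword t ht.pos k = w k
    rw [borderWord_toDiagram_join t ht, subword_join _ _ _ (by omega), symmetricFamily_of_lt]
  right_inv lam := by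
    have h2 := two_mul_half t ht
    have hc := conj_borderWord_of_mem_BG t ht lam.2
    refine Subtype.ext (Eq.trans (congrArg toDiagram ?_) (toDiagram_borderWord lam.1))
    refine eq_of_subword_eq t ht.pos fun k hk => ?_
    rw [subword_join _ _ _ hk]
    rcases lt_trichotomy k ((t - 1) / 2) with h | h | h
    · exact symmetricFamily_of_lt _ ⟨k, h⟩
    · rw [h, symmetricFamily_self, subword_half_of_mem_BG t ht lam.2]
    · rw [show k = 2 * ((t - 1) / 2) - (2 * ((t - 1) / 2) - k) by omega,
        symmetricFamily_reflect _ (by omega),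
        symmetricFamily_of_lt _ ⟨2 * ((t - 1) / 2) - k, by omega⟩,
        ← subword_reflect t hc ht.pos (by dsimp only; omega)]
      congr 1
      dsimp only
      omega

/-- The element of `BG t` with given first half of the charges and of the quotient. -/
noncomputable def ofCharges (p : (Fin ((t - 1) / 2) → ℤ) × (Fin ((t - 1) / 2) → YoungDiagram)) :
    BG t ht :=
  equivWords t ht fun k => shiftedWord (p.1 k) (p.2 k)

theorem ofCharges_bijective : Function.Bijective (ofCharges t ht) := by
  refine (equivWords t ht).bijective.comp ⟨fun p p' h => ?_, fun w => ?_⟩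
  · have h1 := fun k => congrArg wordEquiv (congrFun h k)
    simp only [wordEquiv, Equiv.coe_fn_mk, charge_shiftedWord, toDiagram_shiftedWord,
      Prod.mk.injEq] at h1
    exact Prod.ext (funext fun k => (h1 k).1) (funext fun k => (h1 k).2)
  · exact ⟨(fun k => (w k).charge, fun k => (w k).toDiagram), funext fun k =>
      wordEquiv.symm_apply_apply (w k)⟩

theorem subword_ofCharges
    (p : (Fin ((t - 1) / 2) → ℤ) × (Fin ((t - 1) / 2) → YoungDiagram)) {k : ℕ} (hk : k < t) :
    (borderWord (ofCharges t ht p).1).subword t ht.pos k =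
      symmetricFamily (fun k => shiftedWord (p.1 k) (p.2 k)) k := by
  rw [ofCharges, equivWords, Equiv.coe_fn_mk, borderWord_toDiagram_join t ht, subword_join _ _ _ hk]

end Odd

/-! ### The size of a diagram -/

theorem card_eq_sum_rowLen {lam : YoungDiagram} {n : ℕ} (h : ∀ r, n ≤ r → lam.rowLen r = 0) :
    lam.card = ∑ r ∈ Finset.range n, lam.rowLen r := by
  rw [YoungDiagram.card, Finset.card_eq_sum_card_fiberwise (f := Prod.fst) (t := Finset.range n)]
  · exact Finset.sum_congr rfl fun r _ => (lam.rowLen_eq_card).symm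
  · rintro ⟨r, s⟩ hu
    have h1 := YoungDiagram.mem_iff_lt_rowLen.mp (YoungDiagram.mem_cells _ |>.mp hu)
    by_contra h2
    have := h r (by simpa using h2)
    omega

namespace BorderWord

variable (c : BorderWord)

/-- The set of the indices `≥ -n` of the letters `0`. -/
noncomputable def zerosFrom (n : ℕ) : Finset ℤ := (c.finite_zerosRight (-n - 1)).toFinset

theorem mem_zerosFrom {n : ℕ} {z : ℤ} : z ∈ c.zerosFrom n ↔ -n ≤ z ∧ c.letter z = false := by
  simp only [zerosFrom, Set.Finite.mem_toFinset, Set.mem_ofPred_eq]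
  exact and_congr_left fun _ => by omega

theorem zerosFrom_eq_image (n : ℕ) :
    c.zerosFrom n = (Finset.range (c.zerosRight (-n - 1))).image c.zeroPos := by
  ext z
  simp only [mem_zerosFrom, Finset.mem_image, Finset.mem_range]
  constructor
  · rintro ⟨h1, h2⟩
    exact ⟨c.zerosRight z, c.zerosRight_lt (by omega) h2, c.zeroPos_zerosRight h2⟩
  · rintro ⟨r, hr, rfl⟩
    refine ⟨?_, c.letter_zeroPos r⟩
    by_contra h
    have := c.zerosRight_antitone (show c.zeroPos r ≤ -n - 1 by omega)
    rw [zerosRight_zeroPos] at this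
    omega

theorem card_zerosFrom {n : ℕ} (h : c.onesLeft (-n) = 0) :
    ((c.zerosFrom n).card : ℤ) = c.charge + n := by
  rw [zerosFrom_eq_image, Finset.card_image_of_injective _ c.zeroPos_injective, Finset.card_range]
  have := c.onesLeft_eq (-n)
  omega

/-- The zeros in the window sit at rowLen r - r - 1 + charge for r < charge + n. The row lengths add
up to the size, and the rest is an arithmetic progression. Doubling avoids division. -/
theorem two_mul_sum_zerosFrom {n : ℕ} (h : c.onesLeft (-n) = 0) :
    2 * ∑ z ∈ c.zerosFrom n, z =
      2 * (c.toDiagram.card : ℤ) + (c.charge + n) * (c.charge - n - 1) := by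
  have h1 : (c.zerosRight (-n - 1) : ℤ) = c.charge + n := by
    have := c.onesLeft_eq (-n)
    omega
  have h2 : ∀ r, c.zerosRight (-n - 1) ≤ r → c.toDiagram.rowLen r = 0 := fun r hr => by
    have := c.onesLeft_monotone (show c.zeroPos r ≤ -n by
      have := c.zeroPos_le hr
      omega)
    rw [rowLen_toDiagram]
    omega
  have h3 : ∀ R : ℕ, 2 * ∑ r ∈ Finset.range R, (-(r : ℤ) - 1 + c.charge) =
      R * (2 * c.charge - R - 1) := fun R => by
    induction R with
    | zero => simp
    | succ R ih =>
      rw [Finset.sum_range_succ, mul_add, ih]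
      push_cast
      ring
  rw [zerosFrom_eq_image, Finset.sum_image fun a _ b _ hab => c.zeroPos_injective hab,
    card_eq_sum_rowLen h2]
  have h4 := h3 (c.zerosRight (-n - 1))
  rw [h1] at h4
  rw [show (c.charge + n) * (c.charge - n - 1) = (c.charge + n) * (2 * c.charge - (c.charge + n) - 1)
    by ring, ← h4, ← mul_add]
  push_cast
  rw [← Finset.sum_add_distrib]
  congr 1
  refine Finset.sum_congr rfl fun r _ => ?_
  rw [zeroPos_eq]
  ring

/-- Division with remainder by t distributes the zeros of index at least -tn over the subwords, each
with the window starting at -n. -/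
theorem sum_zerosFrom_mul (t : ℕ) (ht : 0 < t) (n : ℕ) :
    ∑ z ∈ c.zerosFrom (t * n), z = ∑ k ∈ Finset.range t,
      ∑ y ∈ (c.subword t ht k).zerosFrom n, ((t : ℤ) * y + k) := by
  have h0 : (0 : ℤ) < t := by exact_mod_cast ht
  rw [Finset.sum_sigma']
  refine Finset.sum_bij' (fun z _ => ⟨(z % t).toNat, z / t⟩) (fun p _ => (t : ℤ) * p.2 + p.1)
    ?_ ?_ ?_ ?_ ?_
  · intro z hz
    rw [mem_zerosFrom] at hz
    have h1 := Int.emod_nonneg z h0.ne'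
    have h2 := Int.emod_lt_of_pos z h0
    rw [Finset.mem_sigma, mem_zerosFrom, letter_subword, Int.toNat_of_nonneg h1,
      Int.mul_ediv_add_emod]
    refine ⟨Finset.mem_range.mpr (by dsimp only; omega), ?_, hz.2⟩
    rw [Int.le_ediv_iff_mul_le h0]
    push_cast at hz
    linarith [hz.1]
  · rintro ⟨k, y⟩ hp
    rw [Finset.mem_sigma, mem_zerosFrom, letter_subword] at hp
    rw [mem_zerosFrom]
    refine ⟨?_, hp.2.2⟩
    have := hp.2.1
    push_cast
    dsimp only at this ⊢
    nlinarith
  · intro z _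
    have h1 := Int.emod_nonneg z h0.ne'
    simp only [Int.toNat_of_nonneg h1, Int.mul_ediv_add_emod]
  · rintro ⟨k, y⟩ hp
    rw [Finset.mem_sigma, Finset.mem_range] at hp
    have hk : k < t := hp.1
    have h1 : ((t : ℤ) * y + k) % t = k := by
      rw [add_comm, Int.add_mul_emod_self_left]
      exact Int.emod_eq_of_lt (by omega) (by omega)
    have h2 : ((t : ℤ) * y + k) / t = y := by
      rw [add_comm, Int.add_mul_ediv_left _ _ (by omega),
        Int.ediv_eq_zero_of_lt (by omega) (by omega), zero_add]
    simp only [h1, h2, Int.toNat_natCast]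
  · intro z _
    have h1 := Int.emod_nonneg z h0.ne'
    simp only [Int.toNat_of_nonneg h1, Int.mul_ediv_add_emod]

/-- The size of a diagram in terms of its quotient and of the charges of its subwords. -/
theorem two_mul_card_toDiagram {c : BorderWord} (hc : c.charge = 0) (t : ℕ) (ht : 0 < t) :
    2 * (c.toDiagram.card : ℤ) = ∑ k ∈ Finset.range t,
      (2 * t * ((c.subword t ht k).toDiagram.card : ℤ) +
        (t * ((c.subword t ht k).charge * ((c.subword t ht k).charge - 1)) +
          2 * k * (c.subword t ht k).charge)) := by
  choose N hN using fun k => (c.subword t ht k).exists_onesLeft_eq_zero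
  obtain ⟨M, hM⟩ := c.exists_onesLeft_eq_zero
  -- One window is large enough for the word and all its subwords; the terms in L cancel at the end.
  set L := M + ∑ k ∈ Finset.range t, N k with hL
  have h1 : ∀ k ∈ Finset.range t, (c.subword t ht k).onesLeft (-L) = 0 := fun k hk => hN k _ (by
    have := Finset.single_le_sum (f := N) (fun _ _ => Nat.zero_le _) hk
    omega)
  have h2 : c.onesLeft (-(t * L : ℕ)) = 0 := hM _ (by
    have : L ≤ t * L := Nat.le_mul_of_pos_left L ht
    omega)
  have h3 := c.two_mul_sum_zerosFrom h2
  rw [hc, c.sum_zerosFrom_mul t ht] at h3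
  have h4 : 2 * ∑ k ∈ Finset.range t,
      ∑ y ∈ (c.subword t ht k).zerosFrom L, ((t : ℤ) * y + k) = ∑ k ∈ Finset.range t,
      (t * (2 * ((c.subword t ht k).toDiagram.card : ℤ) + ((c.subword t ht k).charge + L) *
        ((c.subword t ht k).charge - L - 1)) + 2 * k * ((c.subword t ht k).charge + L)) := by
    rw [Finset.mul_sum]
    refine Finset.sum_congr rfl fun k hk => ?_
    rw [Finset.sum_add_distrib, ← Finset.mul_sum, Finset.sum_const, nsmul_eq_mul,
      card_zerosFrom _ (h1 k hk), ← two_mul_sum_zerosFrom _ (h1 k hk)]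
    ring
  have h5 : ∑ k ∈ Finset.range t, (2 * (k : ℤ)) = t * (t - 1) := by
    clear * -
    induction t with
    | zero => simp
    | succ t ih =>
      rw [Finset.sum_range_succ, ih]
      push_cast
      ring
  have h6 : ∑ k ∈ Finset.range t, ((2 * (k : ℤ)) * L - t * (L * (L + 1))) =
      t * (t - 1) * L - t * (t * (L * (L + 1))) := by
    rw [Finset.sum_sub_distrib, ← Finset.sum_mul, h5, Finset.sum_const, Finset.card_range,
      nsmul_eq_mul]
  rw [h4] at h3
  have h7 : ∑ k ∈ Finset.range t,
      (t * (2 * ((c.subword t ht k).toDiagram.card : ℤ) + ((c.subword t ht k).charge + L) *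
        ((c.subword t ht k).charge - L - 1)) + 2 * k * ((c.subword t ht k).charge + L)) =
      ∑ k ∈ Finset.range t,
      (2 * t * ((c.subword t ht k).toDiagram.card : ℤ) +
        (t * ((c.subword t ht k).charge * ((c.subword t ht k).charge - 1)) +
          2 * k * (c.subword t ht k).charge)) +
      ∑ k ∈ Finset.range t, ((2 * (k : ℤ)) * L - t * (L * (L + 1))) := by
    rw [← Finset.sum_add_distrib]
    exact Finset.sum_congr rfl fun k _ => by ring
  rw [h7, h6] at h3
  push_cast at h3
  linarith [h3]

end BorderWord

/-- Pairs each residue with its mirror image under conjugation and isolates the middle one. -/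
theorem prod_range_odd {M : Type*} [CommMonoid M] (f : ℕ → M) {m t : ℕ} (h : 2 * m + 1 = t) :
    ∏ k ∈ Finset.range t, f k = (∏ k : Fin m, f k * f (2 * m - k)) * f m := by
  rw [← h, show 2 * m + 1 = (m + 1) + m by ring, Finset.prod_range_add, Finset.prod_range_succ,
    ← Finset.prod_range_reflect (fun x => f (m + 1 + x)), Finset.prod_mul_distrib,
    Fin.prod_univ_eq_prod_range, Fin.prod_univ_eq_prod_range (fun k => f (2 * m - k)), mul_right_comm]
  congr 2
  refine Finset.prod_congr rfl fun k hk => ?_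
  rw [Finset.mem_range] at hk
  congr 1
  omega

theorem sum_range_odd {M : Type*} [AddCommMonoid M] (f : ℕ → M) {m t : ℕ} (h : 2 * m + 1 = t) :
    ∑ k ∈ Finset.range t, f k = (∑ k : Fin m, (f k + f (2 * m - k))) + f m :=
  prod_range_odd (M := Multiplicative M) f h

theorem card_ofCharges (t : ℕ) (ht : Odd t) (n : Fin ((t - 1) / 2) → ℤ)
    (nu : Fin ((t - 1) / 2) → YoungDiagram) :
    (ofCharges t ht (n, nu)).1.card =
      (ofCharges t ht (n, fun _ => ⊥)).1.card + 2 * t * ∑ k, (nu k).card := by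
  have ht2 := two_mul_half t ht
  -- Twice the size is a quotient part plus a term `a` involving the charges alone. Since `a` is the
  -- same for empty quotients, no explicit core size is needed.
  have key : ∀ p : (Fin ((t - 1) / 2) → ℤ) × (Fin ((t - 1) / 2) → YoungDiagram), ∃ a : ℤ,
      a = ∑ k ∈ Finset.range t,
        (t * ((symmetricFamily (fun k => shiftedWord (p.1 k) ⊥) k).charge *
          ((symmetricFamily (fun k => shiftedWord (p.1 k) ⊥) k).charge - 1)) +
          2 * k * (symmetricFamily (fun k => shiftedWord (p.1 k) ⊥) k).charge) ∧
      2 * ((ofCharges t ht p).1.card : ℤ) = 2 * t * (2 * ∑ k, ((p.2 k).card : ℤ)) + a := by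
    intro p
    refine ⟨_, rfl, ?_⟩
    have h1 := two_mul_card_toDiagram (charge_borderWord (ofCharges t ht p).1) t ht.pos
    rw [toDiagram_borderWord] at h1
    rw [h1, Finset.sum_add_distrib]
    congr 1
    · rw [← Finset.mul_sum]
      congr 1
      rw [Finset.sum_congr rfl fun k hk => by
        rw [subword_ofCharges t ht p (Finset.mem_range.mp hk)]]
      rw [sum_range_odd _ ht2, symmetricFamily_self, toDiagram_borderWord, Finset.mul_sum]
      simp only [YoungDiagram.card, YoungDiagram.cells_bot, Finset.card_empty, Nat.cast_zero,
        add_zero]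
      refine Finset.sum_congr rfl fun k _ => ?_
      rw [symmetricFamily_reflect _ (by omega), symmetricFamily_of_lt, toDiagram_conj,
        toDiagram_shiftedWord]
      have : (p.2 k).transpose.cells.card = (p.2 k).cells.card :=
        Finset.card_map _
      rw [this]
      ring
    · refine Finset.sum_congr rfl fun k hk => ?_
      rw [subword_ofCharges t ht p (Finset.mem_range.mp hk)]
      have : (symmetricFamily (fun k => shiftedWord (p.1 k) (p.2 k)) k).charge =
          (symmetricFamily (fun k => shiftedWord (p.1 k) ⊥) k).charge := by
        unfold symmetricFamily
        split_ifs <;> simp [charge_conj]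
      rw [this]
  obtain ⟨a, ha, h1⟩ := key (n, nu)
  obtain ⟨b, hb, h2⟩ := key (n, fun _ => ⊥)
  have hab : a = b := ha.trans hb.symm
  have h3 : ((⊥ : YoungDiagram).card : ℤ) = 0 := by simp [YoungDiagram.card]
  simp only [h3, Finset.sum_const_zero, mul_zero, zero_add] at h2
  zify
  linarith

open BorderWord

namespace BorderWord

variable (c : BorderWord)

/-! ### Inversions and hooks -/

/-- The pairs of indices `i < j` with letters `1` and `0`; they correspond to the boxes of the
diagram. -/
noncomputable def inversions : Finset (ℤ × ℤ) :=
  c.toDiagram.cells.image fun u => (c.onePos u.2, c.zeroPos u.1)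

theorem mem_inversions {p : ℤ × ℤ} :
    p ∈ c.inversions ↔ p.1 < p.2 ∧ c.letter p.1 = true ∧ c.letter p.2 = false := by
  obtain ⟨i, j⟩ := p
  simp only [inversions, Finset.mem_image, Prod.exists, Prod.mk.injEq, YoungDiagram.mem_cells,
    mem_toDiagram]
  constructor
  · rintro ⟨r, s, h, rfl, rfl⟩
    exact ⟨h, c.letter_onePos s, c.letter_zeroPos r⟩
  · rintro ⟨h, hi, hj⟩
    refine ⟨c.zerosRight j, c.onesLeft i, ?_, c.onePos_onesLeft hi, c.zeroPos_zerosRight hj⟩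
    rwa [onePos_onesLeft _ hi, zeroPos_zerosRight _ hj]

theorem onePos_zeroPos_injective :
    Function.Injective fun u : ℕ × ℕ => (c.onePos u.2, c.zeroPos u.1) := fun _ _ h =>
  Prod.ext (c.zeroPos_injective (Prod.mk.inj h).2) (c.onePos_injective (Prod.mk.inj h).1)

variable {M : Type*} [CommMonoid M]

theorem prod_inversions (f : ℤ × ℤ → M) :
    ∏ p ∈ c.inversions, f p = ∏ u ∈ c.toDiagram.cells, f (c.onePos u.2, c.zeroPos u.1) :=
  Finset.prod_image fun _ _ _ _ h => c.onePos_zeroPos_injective h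

theorem prod_inversions_hook (f : ℤ → M) :
    ∏ p ∈ c.inversions, f (p.2 - p.1) = ∏ u ∈ c.toDiagram.cells, f (hook c.toDiagram u) := by
  rw [prod_inversions]
  refine Finset.prod_congr rfl fun u hu => ?_
  rw [c.hook_toDiagram (YoungDiagram.mem_cells _ |>.mp hu)]

theorem prod_inversions_conj (f : ℤ × ℤ → M) :
    ∏ p ∈ c.conj.inversions, f p = ∏ p ∈ c.inversions, f (-1 - p.2, -1 - p.1) := by
  refine Finset.prod_bij' (fun p _ => (-1 - p.2, -1 - p.1)) (fun p _ => (-1 - p.2, -1 - p.1))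
    ?_ ?_ ?_ ?_ ?_
  · intro p hp
    rw [mem_inversions, letter_conj, letter_conj] at hp
    rw [mem_inversions]
    exact ⟨by dsimp only; omega, by simpa using hp.2.2, by simpa using hp.2.1⟩
  · intro p hp
    rw [mem_inversions] at hp
    rw [mem_inversions, letter_conj, letter_conj]
    exact ⟨by dsimp only; omega, by simpa using hp.2.2, by simpa using hp.2.1⟩
  · simp
  · simp
  · simp

/-- The two indices of an inversion differ by a multiple of t exactly when both letters belong to
the same subword. -/
theorem prod_inversions_filter_dvd (t : ℕ) (ht : 0 < t) (f : ℤ × ℤ → M) :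
    ∏ p ∈ c.inversions.filter (fun p => (t : ℤ) ∣ p.2 - p.1), f p =
      ∏ k ∈ Finset.range t, ∏ p ∈ (c.subword t ht k).inversions,
        f (t * p.1 + k, t * p.2 + k) := by
  have h0 : (0 : ℤ) < t := by exact_mod_cast ht
  have hmod : ∀ {p : ℤ × ℤ}, (t : ℤ) ∣ p.2 - p.1 → p.2 % t = p.1 % t := fun h =>
    (Int.emod_emod_of_dvd _ (dvd_refl (t : ℤ))).symm.trans
      ((Int.emod_emod_of_dvd _ (dvd_refl (t : ℤ))).trans (Int.emod_eq_emod_iff_emod_sub_eq_zero.mpr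
        (Int.emod_eq_zero_of_dvd h)))
  have key : ∀ p ∈ c.inversions.filter (fun p => (t : ℤ) ∣ p.2 - p.1),
      ((t : ℤ) * (p.1 / t) + ((p.1 % t).toNat : ℕ), (t : ℤ) * (p.2 / t) + ((p.1 % t).toNat : ℕ)) =
        p := by
    intro p hp
    rw [Finset.mem_filter] at hp
    refine Prod.ext ?_ ?_
    · rw [Int.toNat_of_nonneg (Int.emod_nonneg _ h0.ne'), Int.mul_ediv_add_emod]
    · rw [Int.toNat_of_nonneg (Int.emod_nonneg _ h0.ne'), ← hmod hp.2, Int.mul_ediv_add_emod]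
  rw [Finset.prod_sigma']
  refine Finset.prod_bij' (fun p _ => ⟨(p.1 % t).toNat, (p.1 / t, p.2 / t)⟩)
    (fun p _ => (t * p.2.1 + p.1, t * p.2.2 + p.1)) ?_ ?_ ?_ ?_ ?_
  · intro p hp
    have hp' := key p hp
    rw [Prod.ext_iff] at hp'
    dsimp only at hp'
    rw [Finset.mem_filter, mem_inversions] at hp
    have h1 := Int.emod_nonneg p.1 h0.ne'
    have h2 := Int.emod_lt_of_pos p.1 h0
    rw [Finset.mem_sigma, mem_inversions, letter_subword, letter_subword]
    dsimp only
    rw [hp'.1, hp'.2]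
    refine ⟨Finset.mem_range.mpr (by omega), ?_, hp.1.2⟩
    by_contra hle
    nlinarith [hp.1.1]
  · rintro ⟨k, a, b⟩ hp
    rw [Finset.mem_sigma, mem_inversions, letter_subword, letter_subword] at hp
    rw [Finset.mem_filter, mem_inversions]
    dsimp only at hp ⊢
    exact ⟨⟨by nlinarith [hp.2.1], hp.2.2⟩, ⟨b - a, by ring⟩⟩
  · exact key
  · rintro ⟨k, a, b⟩ hp
    rw [Finset.mem_sigma, Finset.mem_range] at hp
    have hk : k < t := hp.1
    have h1 : ∀ y : ℤ, ((t : ℤ) * y + k) % t = k := fun y => by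
      rw [add_comm, Int.add_mul_emod_self_left]
      exact Int.emod_eq_of_lt (by omega) (by omega)
    have h2 : ∀ y : ℤ, ((t : ℤ) * y + k) / t = y := fun y => by
      rw [add_comm, Int.add_mul_ediv_left _ _ (by omega),
        Int.ediv_eq_zero_of_lt (by omega) (by omega), zero_add]
    simp only [h1, h2, Int.toNat_natCast]
  · intro p hp
    exact congrArg f (key p hp).symm

end BorderWord

/-! ### Signed hooks of multiples of t -/

theorem hook_eq (lam : YoungDiagram) {u : ℕ × ℕ} (hu : u ∈ lam) :
    (hook lam u : ℤ) = (borderWord lam).zeroPos u.1 - (borderWord lam).onePos u.2 := by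
  have := (borderWord lam).hook_toDiagram (r := u.1) (s := u.2)
  rw [toDiagram_borderWord] at this
  exact this hu

/-- Self-conjugacy gives onePos s = -1 - zeroPos s, so the quantity tested is zeroPos r - zeroPos s,
and `zeroPos` is strictly decreasing. -/
theorem boxSign_eq {lam : YoungDiagram} (h : (borderWord lam).conj = borderWord lam) (u : ℕ × ℕ) :
    boxSign u =
      if (borderWord lam).onePos u.2 + (borderWord lam).zeroPos u.1 + 1 < 0 then -1 else 1 := by
  have h1 := (borderWord lam).zeroPos_conj u.2
  rw [h] at h1
  have h2 : StrictAnti (borderWord lam).zeroPos := fun a b hab => by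
    have := lam.rowLen_anti a b hab.le
    rw [zeroPos_borderWord, zeroPos_borderWord]
    omega
  have h3 := h2.lt_iff_gt (a := u.1) (b := u.2)
  rw [boxSign]
  exact if_congr (by rw [← h3]; omega) rfl rfl

/-- The multiples of t among the hooks are t times the hooks of the quotient. Components k and t-1-k
are conjugate, and corresponding boxes have opposite signs, which produces the factors at 1 and -1.
-/
theorem prod_hookBoxes {M : Type*} [CommMonoid M] (t : ℕ) (ht : Odd t) {lam : YoungDiagram}
    (h : lam ∈ BG t ht) (f : ℤ → ℤˣ → M) :
    ∏ u ∈ hookBoxes t lam, f (hook lam u) (boxSign u) = ∏ k : Fin ((t - 1) / 2),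
      ∏ u ∈ (quotientComponent t ht.pos lam k).cells,
        (f (t * hook (quotientComponent t ht.pos lam k) u) 1 *
          f (t * hook (quotientComponent t ht.pos lam k) u) (-1)) := by
  have ht2 := two_mul_half t ht
  set m := (t - 1) / 2 with hm
  set c := borderWord lam with hc
  have hcc : c.conj = c := conj_borderWord_of_mem_BG t ht h
  let g : ℤ × ℤ → M := fun p => f (p.2 - p.1) (if p.1 + p.2 + 1 < 0 then -1 else 1)
  have h1 : ∏ u ∈ hookBoxes t lam, f (hook lam u) (boxSign u) =
      ∏ p ∈ c.inversions.filter (fun p => (t : ℤ) ∣ p.2 - p.1), g p := by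
    rw [Finset.prod_filter, prod_inversions, toDiagram_borderWord, hookBoxes, Finset.prod_filter]
    refine Finset.prod_congr rfl fun u hu => ?_
    have hh := hook_eq lam (YoungDiagram.mem_cells _ |>.mp hu)
    rw [← hc] at hh
    rw [boxSign_eq hcc]
    simp only [g, ← hc, ← hh, ← Int.natCast_dvd_natCast]
  rw [h1, prod_inversions_filter_dvd _ t ht.pos, prod_range_odd _ ht2]
  have h2 : (c.subword t ht.pos m).inversions = ∅ := by
    have : (c.subword t ht.pos m).toDiagram = ⊥ := h.2
    rw [inversions, this]
    rfl
  rw [h2, Finset.prod_empty, mul_one]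
  refine Finset.prod_congr rfl fun k _ => ?_
  have hk := k.2
  rw [show 2 * m - (k : ℕ) = t - 1 - k by omega, subword_reflect t hcc ht.pos (by omega),
    prod_inversions_conj, ← Finset.prod_mul_distrib]
  refine Eq.trans (Finset.prod_congr rfl fun p _ => ?_)
    ((c.subword t ht.pos k).prod_inversions_hook fun h => f (t * h) 1 * f (t * h) (-1))
  have e1 : (t : ℤ) * p.2 + ↑↑k - (t * p.1 + ↑↑k) = t * (p.2 - p.1) := by ring
  have e2 : (t : ℤ) * (-1 - p.1) + (t - 1 - ↑↑k) - (t * (-1 - p.2) + (t - 1 - ↑↑k)) =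
    t * (p.2 - p.1) := by ring
  have e3 : ((t - 1 - (k : ℕ) : ℕ) : ℤ) = t - 1 - k := by omega
  simp only [g, e1, e3, e2]
  have ht3 : (t : ℤ) = 2 * m + 1 := by omega
  have hk' : (k : ℤ) < m := by exact_mod_cast hk
  have e4 : (t : ℤ) * p.1 + ↑↑k + (t * p.2 + ↑↑k) + 1 = t * (p.1 + p.2) + 2 * ↑↑k + 1 := by ring
  have e5 : (t : ℤ) * (-1 - p.2) + (t - 1 - ↑↑k) + (t * (-1 - p.1) + (t - 1 - ↑↑k)) + 1 =
    -(t * (p.1 + p.2) + 2 * ↑↑k + 1) := by ring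
  rw [e4, e5]
  -- Since 0 < 2k+1 < t, the number t(p.1 + p.2) + 2k + 1 is never zero and is negative exactly when
  -- p.1 + p.2 is. So exactly one of the two mirrored boxes lies below the diagonal.
  rcases le_or_gt 0 (p.1 + p.2) with hs | hs
  · have h3 : 0 ≤ (t : ℤ) * (p.1 + p.2) := by positivity
    rw [if_neg (by omega), if_pos (by omega)]
  · have h3 : (t : ℤ) * (p.1 + p.2) ≤ -t := by nlinarith
    rw [if_pos (by omega), if_neg (by omega), mul_comm]

theorem sum_hookBoxes {M : Type*} [AddCommMonoid M] (t : ℕ) (ht : Odd t) {lam : YoungDiagram}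
    (h : lam ∈ BG t ht) (f : ℤ → ℤˣ → M) :
    ∑ u ∈ hookBoxes t lam, f (hook lam u) (boxSign u) = ∑ k : Fin ((t - 1) / 2),
      ∑ u ∈ (quotientComponent t ht.pos lam k).cells,
        (f (t * hook (quotientComponent t ht.pos lam k) u) 1 +
          f (t * hook (quotientComponent t ht.pos lam k) u) (-1)) :=
  prod_hookBoxes (M := Multiplicative M) t ht h f

theorem card_hookBoxes (t : ℕ) (ht : Odd t) {lam : YoungDiagram} (h : lam ∈ BG t ht) :
    (hookBoxes t lam).card =
      2 * ∑ k : Fin ((t - 1) / 2), (quotientComponent t ht.pos lam k).card := by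
  have := sum_hookBoxes t ht h fun _ _ => 1
  rw [Finset.card_eq_sum_ones, this, Finset.mul_sum]
  exact Finset.sum_congr rfl fun k _ => by
    rw [Finset.sum_const, smul_eq_mul, mul_comm, YoungDiagram.card]

theorem quotientComponent_ofCharges (t : ℕ) (ht : Odd t)
    (p : (Fin ((t - 1) / 2) → ℤ) × (Fin ((t - 1) / 2) → YoungDiagram)) (k : Fin ((t - 1) / 2)) :
    quotientComponent t ht.pos (ofCharges t ht p).1 k = p.2 k := by
  have := two_mul_half t ht
  rw [quotientComponent, subword_ofCharges t ht p (by omega), symmetricFamily_of_lt,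
    toDiagram_shiftedWord]

/-! ### Self-conjugate partitions and sets of diagonal hooks -/

/-- The self-conjugate word whose letters `0` of nonnegative index are given. -/
def diagonalWord (D : Finset ℕ) : BorderWord where
  letter i := if 0 ≤ i then decide (i.toNat ∉ D) else decide ((-1 - i).toNat ∈ D)
  ends := by
    refine ⟨D.sup id + 1, fun i hi => ?_, fun i hi => ?_⟩
    · rw [if_neg (by omega), decide_eq_false_iff_not]
      intro h
      have := Finset.le_sup (f := id) h
      simp only [id_eq] at this
      omega
    · rw [if_pos (by omega), decide_eq_true_eq]
      intro h
      have := Finset.le_sup (f := id) h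
      simp only [id_eq] at this
      omega

theorem conj_diagonalWord (D : Finset ℕ) : (diagonalWord D).conj = diagonalWord D := by
  ext i
  simp only [letter_conj, diagonalWord, sub_sub_cancel]
  split_ifs with h1 h2 h2
  · omega
  · simp
  · simp
  · omega

theorem mem_iff_letter_diagonalWord {D : Finset ℕ} {d : ℕ} :
    d ∈ D ↔ (diagonalWord D).letter d = false := by
  simp [diagonalWord]

theorem borderWord_toDiagram_diagonalWord (D : Finset ℕ) :
    borderWord (diagonalWord D).toDiagram = diagonalWord D :=
  borderWord_toDiagram (charge_eq_zero_of_conj_eq (conj_diagonalWord D))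

theorem sum_zerosFrom_diagonalWord {D : Finset ℕ} {n : ℕ} (h : ∀ d ∈ D, d < n) :
    2 * ∑ z ∈ (diagonalWord D).zerosFrom n, z = 2 * ∑ d ∈ D, (2 * (d : ℤ) + 1) - n * (n + 1) := by
  have h1 : (diagonalWord D).zerosFrom n = D.map Nat.castEmbedding ∪
      (Finset.range n \ D).image fun i : ℕ => -1 - (i : ℤ) := by
    ext z
    simp only [mem_zerosFrom, Finset.mem_union, Finset.mem_map, Finset.mem_image, Finset.mem_sdiff,
      Finset.mem_range, Nat.castEmbedding_apply, diagonalWord]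
    constructor
    · rintro ⟨hz, hz'⟩
      split_ifs at hz' with h0
      · exact Or.inl ⟨z.toNat, by simpa using hz', by omega⟩
      · exact Or.inr ⟨(-1 - z).toNat, ⟨by omega, by simpa using hz'⟩, by omega⟩
    · rintro (⟨d, hd, rfl⟩ | ⟨i, ⟨hi, hi'⟩, rfl⟩)
      · exact ⟨by omega, by simp [hd]⟩
      · exact ⟨by omega, by rw [if_neg (by omega)]; simpa using hi'⟩
  have h2 : Disjoint (D.map (Nat.castEmbedding (R := ℤ)))
      ((Finset.range n \ D).image fun i : ℕ => -1 - (i : ℤ)) := by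
    rw [Finset.disjoint_left]
    simp only [Finset.mem_map, Finset.mem_image, Nat.castEmbedding_apply]
    rintro _ ⟨d, _, rfl⟩ ⟨i, _, hi⟩
    omega
  have h3 : D ⊆ Finset.range n := fun d hd => Finset.mem_range.mpr (h d hd)
  have h4 : 2 * ∑ i ∈ Finset.range n, (-1 - (i : ℤ)) = - (n * (n + 1)) := by
    clear * -
    induction n with
    | zero => simp
    | succ n ih =>
      rw [Finset.sum_range_succ, mul_add, ih]
      push_cast
      ring
  rw [h1, Finset.sum_union h2, Finset.sum_map, Finset.sum_image (fun a _ b _ hab => by simpa using hab)]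
  have h5 := Finset.sum_sdiff (f := fun i : ℕ => -1 - (i : ℤ)) h3
  have h6 : ∑ d ∈ D, (2 * (d : ℤ) + 1) = ∑ d ∈ D, (d : ℤ) - ∑ d ∈ D, (-1 - (d : ℤ)) := by
    rw [← Finset.sum_sub_distrib]
    exact Finset.sum_congr rfl fun d _ => by ring
  simp only [Nat.castEmbedding_apply]
  linarith

/-- A zero at index d ≥ 0 is mirrored by a 1 at -1 - d, which gives a diagonal hook of length 2d +
1. -/
theorem card_toDiagram_diagonalWord (D : Finset ℕ) :
    (diagonalWord D).toDiagram.card = ∑ d ∈ D, (2 * d + 1) := by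
  obtain ⟨N, hN⟩ := (diagonalWord D).exists_onesLeft_eq_zero
  have h1 := (diagonalWord D).two_mul_sum_zerosFrom (n := N + (D.sup id + 1)) (hN _ (by omega))
  rw [charge_eq_zero_of_conj_eq (conj_diagonalWord D), sum_zerosFrom_diagonalWord fun d hd => by
    have := Finset.le_sup (f := id) hd
    simp only [id_eq] at this
    omega] at h1
  zify
  linarith

section Diagonal

variable (t : ℕ) (ht : Odd t)

/-- The middle residue class is stable under i ↦ -1 - i, so its subword is trivial as soon as it has
no zero of nonnegative index. -/
theorem toDiagram_diagonalWord_mem_BG_iff (D : Finset ℕ) :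
    (diagonalWord D).toDiagram ∈ BG t ht ↔ ∀ d ∈ D, d % t ≠ (t - 1) / 2 := by
  have ht2 := two_mul_half t ht
  constructor
  · intro h d hd hdt
    have h1 := congrArg (fun w => w.letter (d / t : ℕ)) (subword_half_of_mem_BG t ht h)
    rw [borderWord_toDiagram_diagonalWord] at h1
    have h2 : (t : ℤ) * (d / t : ℕ) + ((t - 1) / 2 : ℕ) = d := by
      rw [← hdt]
      exact_mod_cast Nat.div_add_mod d t
    simp only [letter_subword, letter_borderWord_bot, h2,
      mem_iff_letter_diagonalWord.mp hd] at h1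
    rw [decide_eq_true (Int.natCast_nonneg _)] at h1
    exact absurd h1 (by decide)
  · intro h
    refine ⟨?_, ?_⟩
    · rw [isSelfConjugate_iff, borderWord_toDiagram_diagonalWord, conj_diagonalWord]
    · rw [quotientComponent, borderWord_toDiagram_diagonalWord]
      suffices (diagonalWord D).subword t ht.pos ((t - 1) / 2) = borderWord ⊥ by
        rw [this, toDiagram_borderWord]
      generalize (t - 1) / 2 = m at ht2 h ⊢
      have key : ∀ n : ℕ, t * n + m ∉ D := fun n hn => h _ hn (by
        rw [Nat.mul_add_mod, Nat.mod_eq_of_lt (by omega)])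
      have h0 : (0 : ℤ) < t := by exact_mod_cast ht.pos
      ext i
      rw [letter_subword, letter_borderWord_bot]
      simp only [diagonalWord]
      rcases le_or_gt 0 i with hi | hi
      · have h1 : ((t : ℤ) * i + (m : ℤ)).toNat = t * i.toNat + m := by
          zify
          rw [Int.toNat_of_nonneg (by positivity), Int.toNat_of_nonneg hi]
        rw [if_pos (by positivity), h1, decide_eq_true (key _), decide_eq_true hi]
      · have h2 : (t : ℤ) * i + (m : ℤ) < 0 := by
          nlinarith [show (m : ℤ) < t by omega]
        have h1 : (-1 - ((t : ℤ) * i + (m : ℤ))).toNat =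
            t * (-1 - i).toNat + m := by
          have h3 : (t : ℤ) = 2 * (m : ℤ) + 1 := by omega
          zify
          rw [Int.toNat_of_nonneg (by omega), Int.toNat_of_nonneg (by omega)]
          -- The reflection -1 - (ti + m) = t(-1 - i) + m holds because t = 2m + 1.
          linear_combination h3
        rw [if_neg (by omega), h1, decide_eq_false (key _), decide_eq_false (not_le.mpr hi)]

/-- The element of `BG t` with given half-lengths of the diagonal hooks. -/
noncomputable def ofDiagonal (D : Finset {d : ℕ // d % t ≠ (t - 1) / 2}) : BG t ht :=
  ⟨(diagonalWord (D.map (Function.Embedding.subtype _))).toDiagram,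
    (toDiagram_diagonalWord_mem_BG_iff t ht _).mpr fun d hd => by
      rw [Finset.mem_map] at hd
      obtain ⟨e, -, rfl⟩ := hd
      exact e.2⟩

theorem card_ofDiagonal (D : Finset {d : ℕ // d % t ≠ (t - 1) / 2}) :
    (ofDiagonal t ht D).1.card = ∑ d ∈ D, (2 * d.1 + 1) := by
  rw [ofDiagonal, card_toDiagram_diagonalWord, Finset.sum_map]
  rfl

theorem ofDiagonal_bijective : Function.Bijective (ofDiagonal t ht) := by
  constructor
  · intro D E h
    have h1 := congrArg (fun l => borderWord l.1) h
    simp only [ofDiagonal, borderWord_toDiagram_diagonalWord] at h1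
    refine Finset.map_injective (Function.Embedding.subtype _) ?_
    ext d
    rw [mem_iff_letter_diagonalWord, h1, ← mem_iff_letter_diagonalWord]
  · intro lam
    have hc := conj_borderWord_of_mem_BG t ht lam.2
    have hfin : {d : ℕ | (borderWord lam.1).letter d = false}.Finite := by
      obtain ⟨N, -, hr⟩ := (borderWord lam.1).ends
      refine (Set.finite_Iio N).subset fun d hd => ?_
      by_contra h
      have : (borderWord lam.1).letter d = false := hd
      rw [hr d (by simpa using h)] at this
      exact absurd this (by decide)
    have hw : diagonalWord hfin.toFinset = borderWord lam.1 := by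
      ext i
      simp only [diagonalWord, Set.Finite.mem_toFinset, Set.mem_ofPred_eq]
      split_ifs with hi
      · rw [Int.toNat_of_nonneg hi]
        simp
      · rw [Int.toNat_of_nonneg (by omega)]
        have := congrArg (fun w => w.letter i) hc
        simp only [letter_conj] at this
        rw [← this]
        simp
    have hlam : (diagonalWord hfin.toFinset).toDiagram = lam.1 := by
      rw [hw, toDiagram_borderWord]
    have hD := (toDiagram_diagonalWord_mem_BG_iff t ht hfin.toFinset).mp (by
      rw [hlam]
      exact lam.2)
    refine ⟨hfin.toFinset.subtype _, Subtype.ext ?_⟩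
    change (diagonalWord ((hfin.toFinset.subtype _).map _)).toDiagram = lam.1
    rw [Finset.subtype_map_of_mem hD]
    exact hlam

end Diagonal

/-! ### Partitions and the partition generating function -/

theorem sum_rowLens (lam : YoungDiagram) : lam.rowLens.sum = lam.card := by
  rw [card_eq_sum_rowLen fun r hr => rowLen_eq_zero_of_colLen_le hr]
  rfl

theorem mem_partitionsOf {n : ℕ} {lam : YoungDiagram} : lam ∈ partitionsOf n ↔ lam.card = n := by
  simp [partitionsOf]

/-- Passes to `Nat.Partition`, to which Euler's product applies; the restriction `True` keeps every
partition. -/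
theorem card_partitionsOf (n : ℕ) :
    (partitionsOf n).card = (Nat.Partition.restricted n fun _ => True).card := by
  refine Finset.card_bij (fun lam hlam => ⟨lam.rowLens, fun {i} hi =>
    lam.pos_of_mem_rowLens i hi, by
      rw [Multiset.sum_coe, sum_rowLens, mem_partitionsOf.mp hlam]⟩) ?_ ?_ ?_
  · intro lam hlam
    simp [Nat.Partition.restricted]
  · intro lam _ mu _ h
    have h1 : (lam.rowLens : Multiset ℕ) = mu.rowLens := congrArg Nat.Partition.parts h
    refine YoungDiagram.equivListRowLens.injective (Subtype.ext ?_)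
    exact List.Perm.eq_of_sortedGE lam.rowLens_sorted mu.rowLens_sorted (Multiset.coe_eq_coe.mp h1)
  · intro p _
    have hs : (p.parts.sort (· ≥ ·)).SortedGE := (p.parts.pairwise_sort (· ≥ ·)).sortedGE
    have hr := YoungDiagram.rowLens_ofRowLens_eq_self (hw := hs) fun i hi =>
      p.parts_pos ((Multiset.mem_sort _).mp hi)
    refine ⟨YoungDiagram.ofRowLens _ hs, ?_, ?_⟩
    · rw [mem_partitionsOf, ← sum_rowLens, hr, ← Multiset.sum_coe, Multiset.sort_eq, p.parts_sum]
    · refine Nat.Partition.ext ?_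
      dsimp only
      rw [hr, Multiset.sort_eq]

/-! ### Infinite sums in a nonarchimedean ring -/

section Nonarchimedean

variable {A : Type*} [CommRing A] [UniformSpace A] [IsUniformAddGroup A] [NonarchimedeanRing A]

theorem hasSum_pi_prod {I : Type*} {m : ℕ} {a : Fin m → I → A} {s : Fin m → A}
    (h : ∀ k, HasSum (a k) (s k)) :
    HasSum (fun w : Fin m → I => ∏ k, a k (w k)) (∏ k, s k) := by
  induction m with
  | zero =>
    simp only [Finset.univ_eq_empty, Finset.prod_empty]
    exact hasSum_unique (fun _ : Fin 0 → I => (1 : A))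
  | succ m ih =>
    rw [← (Fin.consEquiv fun _ => I).hasSum_iff, Fin.prod_univ_succ]
    convert (h 0).mul_of_nonarchimedean (ih fun k => h k.succ) using 1
    funext p
    simp [Fin.prod_univ_succ, Fin.consEquiv]

/-- Expanding the sum over k, the j-th term replaces a by ab in coordinate j only and contributes
f^(m-1) g. For m = 0 the truncated exponent is harmless, being multiplied by 0. -/
theorem hasSum_pi_prod_mul_sum {I : Type*} (m : ℕ) {a b : I → A} {f g : A}
    (hf : HasSum a f) (hg : HasSum (fun i => a i * b i) g) :
    HasSum (fun w : Fin m → I => (∏ k, a (w k)) * ∑ k, b (w k)) (m * f ^ (m - 1) * g) := by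
  have h1 : ∀ j : Fin m, HasSum (fun w : Fin m → I => (∏ k, a (w k)) * b (w j))
      (f ^ (m - 1) * g) := by
    intro j
    have h2 := hasSum_pi_prod (a := Function.update (fun _ => a) j fun i => a i * b i)
      (s := Function.update (fun _ => f) j g) fun k => by
        rcases eq_or_ne k j with rfl | hk
        · simpa using hg
        · simpa [hk] using hf
    have h3 : ∏ k, Function.update (fun _ : Fin m => f) j g k = f ^ (m - 1) * g := by
      rw [Finset.prod_update_of_mem (Finset.mem_univ j), Finset.prod_const, mul_comm,
        Finset.card_sdiff]
      simp
    rw [h3] at h2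
    convert h2 using 1
    funext w
    rw [← Finset.mul_prod_erase _ _ (Finset.mem_univ j), ← Finset.mul_prod_erase _ _
      (Finset.mem_univ j), Function.update_self, mul_right_comm]
    congr 1
    refine Finset.prod_congr rfl fun k hk => ?_
    rw [Function.update_of_ne (Finset.ne_of_mem_erase hk)]
  have h2 := hasSum_sum fun (j : Fin m) (_ : j ∈ Finset.univ) => h1 j
  simp only [← Finset.mul_sum, Finset.sum_const, Finset.card_univ, Fintype.card_fin,
    nsmul_eq_mul] at h2
  rw [mul_assoc, mul_left_comm]
  exact h2

end Nonarchimedean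

/-! ### Convergence of families of power series -/

theorem summable_of_finite_ne_zero {R I : Type*} [CommRing R] [TopologicalSpace R]
    {a : I → MvPowerSeries (Fin 2) R}
    (h : ∀ d, {i | MvPowerSeries.coeff d (a i) ≠ 0}.Finite) : Summable a := by
  refine ⟨fun d => ∑ i ∈ (h d).toFinset, MvPowerSeries.coeff d (a i),
    MvPowerSeries.WithPiTopology.hasSum_iff_hasSum_coeff.mpr fun d => ?_⟩
  exact hasSum_sum_of_ne_finset_zero fun i hi => by simpa using hi

theorem summable_q_pow_card (R : Type*) [CommRing R] [TopologicalSpace R] (t : ℕ) (ht : Odd t) :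
    Summable fun lam : BG t ht => q R ^ lam.1.card := by
  refine summable_of_finite_ne_zero fun d => ?_
  refine ((finite_card_eq (d 0)).preimage Subtype.val_injective.injOn).subset fun lam hlam => ?_
  simp only [Set.mem_ofPred_eq, MvPowerSeries.coeff_X_pow, ne_eq, ite_eq_right_iff,
    not_forall] at hlam
  obtain ⟨h, -⟩ := hlam
  simp [h]

section Discrete

open scoped PowerSeries.WithPiTopology

variable {R : Type*} [CommRing R] [UniformSpace R] [DiscreteUniformity R]

/-- With discrete coefficients, open ideals form a basis of neighbourhoods of 0. This lets summable
families be multiplied freely. -/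
instance nonarchimedeanRing_mvPowerSeries : NonarchimedeanRing (MvPowerSeries (Fin 2) R) where
  is_nonarchimedean U hU := by
    obtain ⟨I, hI, hIU⟩ := (IsLinearTopology.hasBasis_open_ideal
      (R := MvPowerSeries (Fin 2) R)).mem_iff.mp hU
    exact ⟨⟨I.toAddSubgroup, hI⟩, hIU⟩

/-- Substitution into a generating series over all partitions. -/
theorem hasSum_subst {y : MvPowerSeries (Fin 2) R} (hy : y.constantCoeff = 0)
    (v : YoungDiagram → R) :
    HasSum (fun nu : YoungDiagram => y ^ nu.card * MvPowerSeries.C (v nu))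
      ((PowerSeries.mk fun n => ∑ nu ∈ partitionsOf n, v nu).subst y) := by
  have hs : PowerSeries.HasSubst y := PowerSeries.HasSubst.of_constantCoeff_zero hy
  have h1 : HasSum (fun nu : YoungDiagram => (PowerSeries.X : PowerSeries R) ^ nu.card *
      PowerSeries.C (v nu)) (PowerSeries.mk fun n => ∑ nu ∈ partitionsOf n, v nu) := by
    rw [PowerSeries.WithPiTopology.hasSum_iff_hasSum_coeff]
    intro n
    have h2 : ∀ nu : YoungDiagram, PowerSeries.coeff n ((PowerSeries.X : PowerSeries R) ^ nu.card *
        PowerSeries.C (v nu)) = if n = nu.card then v nu else 0 := fun nu => by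
      rw [PowerSeries.coeff_mul_C, PowerSeries.coeff_X_pow]
      simp
    simp only [h2, PowerSeries.coeff_mk]
    have h3 := hasSum_sum_of_ne_finset_zero (L := SummationFilter.unconditional YoungDiagram)
      (f := fun nu : YoungDiagram => if n = nu.card then v nu else 0)
      (s := partitionsOf n) fun nu hnu => if_neg fun h => hnu (mem_partitionsOf.mpr h.symm)
    rwa [Finset.sum_congr rfl fun nu hnu => if_pos (mem_partitionsOf.mp hnu).symm] at h3
  have h2 := h1.map (PowerSeries.substAlgHom hs) (by
    rw [PowerSeries.coe_substAlgHom]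
    exact MvPowerSeries.continuous_subst hs.const)
  rw [PowerSeries.coe_substAlgHom] at h2
  convert h2 using 1
  funext nu
  rw [Function.comp_apply, ← PowerSeries.coe_substAlgHom hs, map_mul, map_pow,
    PowerSeries.substAlgHom_X, PowerSeries.coe_substAlgHom, PowerSeries.subst_C]

/-- Euler's product for the partition generating function. -/
theorem hasProd_one_sub_pow {y : MvPowerSeries (Fin 2) R} (hy : y.constantCoeff = 0) :
    ∃ e, HasProd (fun j : ℕ => 1 - y * y ^ j) e ∧
      (PowerSeries.mk fun n => ∑ _nu ∈ partitionsOf n, (1 : R)).subst y * e = 1 := by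
  have hs : PowerSeries.HasSubst y := PowerSeries.HasSubst.of_constantCoeff_zero hy
  have hc : Continuous (PowerSeries.substAlgHom (R := R) hs) := by
    rw [PowerSeries.coe_substAlgHom]
    exact MvPowerSeries.continuous_subst hs.const
  obtain ⟨e, h1⟩ := PowerSeries.WithPiTopology.multipliable_one_sub_X_pow R
  have h2 := Nat.Partition.hasProd_powerSeriesMk_card_restricted R fun _ => True
  have h3 := h2.mul h1
  -- Each factor of the partition product is a geometric series, inverse to the matching factor 1 -
  -- X^(i+1).
  have h4 : (fun i : ℕ => (if True then ∑' j : ℕ, (PowerSeries.X : PowerSeries R) ^ ((i + 1) * j)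
      else 1) * (1 - PowerSeries.X ^ (i + 1))) = fun _ => 1 := by
    funext i
    simp only [if_true, pow_mul]
    exact PowerSeries.WithPiTopology.tsum_pow_mul_one_sub_of_constantCoeff_eq_zero (by simp)
  rw [h4] at h3
  have h5 := hasProd_one.unique h3
  refine ⟨e.subst y, ?_, ?_⟩
  · convert h1.map (PowerSeries.substAlgHom (R := R) hs) hc using 1
    · funext j
      rw [Function.comp_apply, map_sub, map_one, map_pow, PowerSeries.substAlgHom_X, pow_succ']
    · rw [PowerSeries.coe_substAlgHom]
  · have h6 := congrArg (PowerSeries.substAlgHom (R := R) hs) h5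
    rw [map_one, map_mul, PowerSeries.coe_substAlgHom] at h6
    simp only [Finset.sum_const, card_partitionsOf, nsmul_eq_mul, mul_one]
    exact h6.symm

/-! ### Sums over `BG t` -/

variable (t : ℕ) (ht : Odd t)

/-- A sum over `BG t` is the product of a sum over the cores and a sum over the quotients. -/
theorem hasSum_BG {f : BG t ht → MvPowerSeries (Fin 2) R}
    {a : (Fin ((t - 1) / 2) → YoungDiagram) → MvPowerSeries (Fin 2) R}
    {s : MvPowerSeries (Fin 2) R} (ha : HasSum a s)
    (hf : ∀ n nu, f (ofCharges t ht (n, nu)) =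
      q R ^ (ofCharges t ht (n, fun _ => ⊥)).1.card * a nu) :
    HasSum f ((∑' n, q R ^ (ofCharges t ht (n, fun _ => ⊥)).1.card) * s) := by
  have hinj : Function.Injective fun n : Fin ((t - 1) / 2) → ℤ =>
      ofCharges t ht (n, fun _ => ⊥) := fun n n' h =>
    (Prod.mk.inj ((ofCharges_bijective t ht).1 h)).1
  rw [← (Equiv.ofBijective _ (ofCharges_bijective t ht)).hasSum_iff]
  have h1 : HasSum (fun p : (Fin ((t - 1) / 2) → ℤ) × (Fin ((t - 1) / 2) → YoungDiagram) =>
      q R ^ (ofCharges t ht (p.1, fun _ => ⊥)).1.card * a p.2)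
      ((∑' n, q R ^ (ofCharges t ht (n, fun _ => ⊥)).1.card) * s) :=
    ((summable_q_pow_card R t ht).comp_injective hinj).hasSum.mul_of_nonarchimedean ha
  convert h1 using 1
  funext p
  exact hf p.1 p.2

/-- The generating function of `BG t` as a product over the diagonal hooks. -/
theorem hasProd_diagonal {s p e : MvPowerSeries (Fin 2) R}
    (hs : HasSum (fun lam : BG t ht => q R ^ lam.1.card) s)
    (hp : HasProd (fun j : ℕ => 1 - -q R * (q R ^ 2) ^ j) p)
    (he : HasProd (fun j : ℕ => 1 - -q R ^ t * (q R ^ (2 * t)) ^ j) e) : s * e = p := by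
  have ht2 := two_mul_half t ht
  have h0 : ∀ j : ℕ, 1 - -q R * (q R ^ 2) ^ j = 1 + q R ^ (2 * j + 1) := fun j => by ring
  simp only [h0] at hp
  rw [← (Equiv.ofBijective _ (ofDiagonal_bijective t ht)).hasSum_iff] at hs
  have h1 : HasSum (fun D : Finset {d : ℕ // d % t ≠ (t - 1) / 2} =>
      ∏ d ∈ D, q R ^ (2 * d.1 + 1)) s := by
    convert hs using 1
    funext D
    rw [Function.comp_apply, Equiv.ofBijective_apply, card_ofDiagonal,
      Finset.prod_pow_eq_pow_sum]
  have h2 := hasProd_one_add_of_hasSum_prod h1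
  -- The excluded d are tj + (t-1)/2, for which 2d + 1 = t + 2tj: these are the factors of (-q^t;
  -- q^(2t))_∞.
  let f : ℕ ≃ {d : ℕ // d ∈ {d : ℕ | d % t ≠ (t - 1) / 2}ᶜ} :=
    { toFun := fun j => ⟨t * j + (t - 1) / 2, by
        simp only [Set.mem_compl_iff, Set.mem_ofPred_eq, not_not]
        rw [Nat.mul_add_mod, Nat.mod_eq_of_lt (by omega)]⟩
      invFun := fun d => d.1 / t
      left_inv := fun j => by
        dsimp only
        rw [Nat.mul_add_div ht.pos, Nat.div_eq_of_lt (by omega), add_zero]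
      right_inv := fun d => Subtype.ext (by
        have h1 : d.1 % t = (t - 1) / 2 := not_not.mp d.2
        have h2 := Nat.div_add_mod d.1 t
        rw [h1] at h2
        exact h2) }
  have h3 : HasProd ((fun d : ℕ => 1 + q R ^ (2 * d + 1)) ∘
      (Subtype.val : {d : ℕ // d ∈ {d : ℕ | d % t ≠ (t - 1) / 2}ᶜ} → ℕ)) e := by
    rw [← f.hasProd_iff]
    convert he using 1
    funext j
    have h4 : 2 * (t * j + (t - 1) / 2) + 1 = t + 2 * t * j := by
      rw [mul_add, add_assoc, ht2]
      ring
    change 1 + q R ^ (2 * (t * j + (t - 1) / 2) + 1) = _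
    rw [h4]
    ring
  have h5 := HasProd.mul_isCompl (f := fun d : ℕ => 1 + q R ^ (2 * d + 1))
    (s := {d : ℕ | d % t ≠ (t - 1) / 2}) isCompl_compl h2 h3
  exact h5.unique hp

end Discrete

/-! ### The core series and the weighted sum -/

section Discrete

variable {R : Type*} [CommRing R] [UniformSpace R] [DiscreteUniformity R]
variable (t : ℕ) (ht : Odd t)

theorem card_hookBoxes_ofCharges (n : Fin ((t - 1) / 2) → ℤ)
    (nu : Fin ((t - 1) / 2) → YoungDiagram) :
    (hookBoxes t (ofCharges t ht (n, nu)).1).card = 2 * ∑ k, (nu k).card := by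
  rw [card_hookBoxes t ht (ofCharges t ht (n, nu)).2]
  simp only [quotientComponent_ofCharges]

/-- The size generating function of the cores in `BG t`. -/
theorem tsum_core_eq {s e : MvPowerSeries (Fin 2) R}
    (hs : HasSum (fun lam : BG t ht => q R ^ lam.1.card) s)
    (he : HasProd (fun j : ℕ => 1 - q R ^ (2 * t) * (q R ^ (2 * t)) ^ j) e) :
    ∑' n, q R ^ (ofCharges t ht (n, fun _ => ⊥)).1.card = e ^ ((t - 1) / 2) * s := by
  have hy : (q R ^ (2 * t)).constantCoeff = 0 := by
    have := ht.pos
    simp [this.ne']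
  obtain ⟨e', he', hmul⟩ := hasProd_one_sub_pow hy
  obtain rfl := he'.unique he
  -- The unweighted sum over BG^t is the core series times the m-th power of the partition series in
  -- q^(2t). Multiplying by the m-th power of the Euler product then isolates the core series.
  have h1 := hasSum_BG t ht (f := fun lam : BG t ht => q R ^ lam.1.card)
    (hasSum_pi_prod fun _ : Fin ((t - 1) / 2) => hasSum_subst hy fun _ => (1 : R)) fun n nu => by
      rw [card_ofCharges t ht n nu, pow_add, pow_mul]
      simp only [map_one, mul_one, Finset.prod_pow_eq_pow_sum]
  rw [hs.unique h1, Finset.prod_const, Finset.card_univ, Fintype.card_fin, mul_left_comm,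
    ← mul_pow, mul_comm e', hmul, one_pow, mul_one]

/-- The weights see only the quotient, so the core series splits off. There are 2 ∑ |ν_k| hooks
divisible by t, hence each box of the quotient carries x² q^(2t). -/
theorem hasSum_BG_hooks (rho1 rho2 : ℤ → ℤˣ → R) {s e : MvPowerSeries (Fin 2) R}
    (hs : HasSum (fun lam : BG t ht => q R ^ lam.1.card) s)
    (he : HasProd (fun j : ℕ => 1 - q R ^ (2 * t) * (q R ^ (2 * t)) ^ j) e) :
    HasSum
      (fun lam : BG t ht =>
        q R ^ lam.1.card * x R ^ (hookBoxes t lam.1).card *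
          MvPowerSeries.C
            ((∏ u ∈ hookBoxes t lam.1, rho1 (hook lam.1 u) (boxSign u)) *
              ∑ u ∈ hookBoxes t lam.1, rho2 (hook lam.1 u) (boxSign u)))
      ((e ^ ((t - 1) / 2) * s) * ((((t - 1) / 2 : ℕ) : MvPowerSeries (Fin 2) R) *
        (fSeries t rho1).subst (x R ^ 2 * q R ^ (2 * t)) ^ ((t - 1) / 2 - 1) *
        (gSeries t rho1 rho2).subst (x R ^ 2 * q R ^ (2 * t)))) := by
  have hy : (x R ^ 2 * q R ^ (2 * t)).constantCoeff = 0 := by simp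
  have hf := hasSum_subst hy fun nu : YoungDiagram =>
    ∏ u ∈ nu.cells, (rho1 (t * hook nu u) 1 * rho1 (t * hook nu u) (-1))
  have hg := hasSum_subst hy fun nu : YoungDiagram =>
    (∏ u ∈ nu.cells, (rho1 (t * hook nu u) 1 * rho1 (t * hook nu u) (-1))) *
      ∑ u ∈ nu.cells, (rho2 (t * hook nu u) 1 + rho2 (t * hook nu u) (-1))
  simp only [map_mul, ← mul_assoc] at hg
  rw [← tsum_core_eq t ht hs he]
  refine hasSum_BG t ht (hasSum_pi_prod_mul_sum ((t - 1) / 2) hf hg) fun n nu => ?_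
  rw [prod_hookBoxes t ht (ofCharges t ht (n, nu)).2, sum_hookBoxes t ht (ofCharges t ht (n, nu)).2,
    card_hookBoxes_ofCharges, card_ofCharges t ht n nu]
  simp only [quotientComponent_ofCharges, map_mul, map_prod, map_sum, Finset.prod_mul_distrib,
    Finset.prod_pow_eq_pow_sum]
  ring

end Discrete

/-- Every factor has constant term 1, and taking the constant term is continuous. -/
theorem isUnit_of_hasProd_one_sub {R : Type*} [CommRing R] [TopologicalSpace R] [T2Space R]
    {a b e : MvPowerSeries (Fin 2) R} (ha : a.constantCoeff = 0)
    (h : HasProd (fun j : ℕ => 1 - a * b ^ j) e) : IsUnit e := by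
  rw [MvPowerSeries.isUnit_iff_constantCoeff]
  have h1 := h.map MvPowerSeries.constantCoeff
    (MvPowerSeries.WithPiTopology.continuous_constantCoeff R)
  have h2 : (MvPowerSeries.constantCoeff ∘ fun j : ℕ => 1 - a * b ^ j) = fun _ => 1 := by
    funext j
    simp [ha]
  rw [h2] at h1
  rw [← hasProd_one.unique h1]
  exact isUnit_one

end LittlewoodSC

/-! ### The theorem over a Hausdorff topological ring -/

theorem theorem6p2 {R : Type*} [CommRing R] [TopologicalSpace R] [IsTopologicalRing R] [T2Space R]
    (t : ℕ) (ht : Odd t) (rho1 rho2 : ℤ → ℤˣ → R) :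
    HasSum
      (fun lam : BG t ht =>
        q R ^ lam.1.card * x R ^ (hookBoxes t lam.1).card *
          MvPowerSeries.C
            ((∏ u ∈ hookBoxes t lam.1, rho1 (hook lam.1 u) (boxSign u)) *
              ∑ u ∈ hookBoxes t lam.1, rho2 (hook lam.1 u) (boxSign u)))
      ((((t - 1) / 2 : ℕ) : MvPowerSeries (Fin 2) R) *
        intPow ((fSeries t rho1).subst (x R ^ 2 * q R ^ (2 * t))) (((t : ℤ) - 3) / 2) *
        (gSeries t rho1 rho2).subst (x R ^ 2 * q R ^ (2 * t)) *
        (qPochhammerInf (q R ^ (2 * t)) (q R ^ (2 * t)) ^ ((t - 1) / 2) *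
          qPochhammerInf (-q R) (q R ^ 2) *
          Ring.inverse (qPochhammerInf (-q R ^ t) (q R ^ (2 * t))))) := by
  have hpos := ht.pos
  have hq : (q R ^ (2 * t)).constantCoeff = 0 := by simp [hpos.ne']
  -- Everything is computed with the discrete topology on R. It is the finest one, so the limits
  -- persist in the given topology, where they are unique.
  have hle := MvPowerSeries.WithPiTopology.instTopologicalSpace_mono (Fin 2)
    (bot_le : (⊥ : TopologicalSpace R) ≤ ‹TopologicalSpace R›)
  have transfer : ∀ {a b e : MvPowerSeries (Fin 2) R},
      @HasProd _ _ _ (@MvPowerSeries.WithPiTopology.instTopologicalSpace (Fin 2) R ⊥)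
        (fun j : ℕ => 1 - a * b ^ j) e (SummationFilter.unconditional ℕ) →
      qPochhammerInf a b = e := fun h => HasProd.tprod_eq (h.mono_right (nhds_mono hle))
  let U : UniformSpace R := ⊥
  have hU : @DiscreteUniformity R U := ⟨rfl⟩
  obtain ⟨e1, he1⟩ := @multipliable_qPochhammerInf R _ ⊥ (q R ^ (2 * t)) (q R ^ (2 * t)) hq
  obtain ⟨e2, he2⟩ := @multipliable_qPochhammerInf R _ ⊥ (-q R) (q R ^ 2) (by simp)
  obtain ⟨e3, he3⟩ := @multipliable_qPochhammerInf R _ ⊥ (-q R ^ t) (q R ^ (2 * t)) hq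
  obtain ⟨s, hs⟩ := @summable_q_pow_card R _ ⊥ t ht
  have hprod := @hasProd_diagonal R _ U hU t ht _ _ _ hs he2 he3
  have hmain := @hasSum_BG_hooks R _ U hU t ht rho1 rho2 _ _ hs he1
  have hunit : IsUnit e3 := @isUnit_of_hasProd_one_sub R _ ⊥ _ _ _ _ (by simp [hpos.ne']) he3
  rw [transfer he1, transfer he2, transfer he3]
  have hs' : s = e2 * Ring.inverse e3 := by
    rw [← hprod, mul_assoc, Ring.mul_inverse_cancel _ hunit, mul_one]
  refine Filter.Tendsto.mono_right ?_ (nhds_mono hle)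
  refine Eq.subst (motive := fun z => @HasSum _ _ _
    (@MvPowerSeries.WithPiTopology.instTopologicalSpace (Fin 2) R ⊥) _ z _) ?_ hmain
  rw [hs']
  -- For t = 1 both values vanish through the factor (t-1)/2, whatever the power with exponent -1
  -- is. Otherwise (t-3)/2 is the natural number (t-1)/2 - 1.
  rcases Nat.eq_zero_or_pos ((t - 1) / 2) with h0 | h0
  · simp [h0]
  · have h1 : ((t : ℤ) - 3) / 2 = Int.ofNat ((t - 1) / 2 - 1) := by
      simp only [Int.ofNat_eq_natCast]
      omega
    rw [h1, intPow]
    ring
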